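/- Let $D>1$ be a squarefree integer and let $\mathcal{O}$ be the ring of integers of $\mathbb{Q}(\sqrt D)$. Let $\mathcal{S}_D$ be the set of all $u=A+B\sqrt D$ with $A,B\in\mathbb{Z}$ such that the norm $N(u)=A^2-B^2D$ is the cube of an integer, $u$ is not a cube in $\mathcal{O}$, and there is no prime whose cube divides both $A$ and $B$. For $u\in\mathcal{S}_D$ let $C=C(u)$ be the product of the distinct odd primes that divide both $A$ and $B$ but do not divide $D$, and put $d=-27C^2D$. Write $\omega=(-1+i\sqrt3)/2$. For $\alpha,\beta\in\mathbb{Z}[\omega]$ with $\beta$ nonzero and coprime to $3$, let $\left(\frac{\alpha}{\beta}\right)_3$ be the cubic residue symbol: for a prime $\pi\nmid 3$ of $\mathbb{Z}[\omega]$ with norm $N\pi$, it is $0$ if $\pi\mid\alpha$, and otherwise it is the unique element of $\{1,\omega,\omega^2\}$ congruent to $\alpha^{(N\pi-1)/3}$ modulo $\pi$; it is extended multiplicatively in $\beta$, with value $1$ when $\beta$ is a unit. **Theorem 2.4.** Let $u=A+B\sqrt D\in\mathcal{S}_D$, and let $f(x,y)=ax^2+2bxy+cy^2$ be a primitive integral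 binary quadratic form (that is, $a,b,c\in\mathbb{Z}$ and $\gcd(a,2b,c)=1$) with $a>0$ and discriminant $4d$, i.e. $b^2-ac=d=-27C^2D$. Let $x,y$ be integers with $$\gcd\bigl(a\,f(x,y),\ 3N(u)Dy\bigr)=1 .$$ Then $L=R$, where $$L=\left(\frac{9Ay+(B/C)(ax+by)(1+2\omega)}{f(x,y)}\right)_3,\qquad R=\left(\frac{9A-(B/C)\,b\,(1+2\omega)}{a}\right)_3 .$$ -/

import Mathlib

/-- The ring `ℤ[ω]` of Eisenstein integers, `ω ^ 2 = -1 - ω`; the element `⟨m, n⟩` is `m + n ω`. -/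
abbrev EisensteinInt : Type := QuadraticAlgebra ℤ (-1) (-1)

namespace EisensteinInt

/-- The primitive cube root of unity `ω = (-1 + i √3) / 2`. -/
def omega : EisensteinInt := ⟨0, 1⟩

/-- The norm `N(m + n ω) = m ^ 2 - m n + n ^ 2`, as a natural number. -/
def normNat (z : EisensteinInt) : ℕ := (QuadraticAlgebra.norm z).natAbs

theorem norm_eq (z : EisensteinInt) :
    QuadraticAlgebra.norm z = z.re ^ 2 - z.re * z.im + z.im ^ 2 := by
  rw [QuadraticAlgebra.norm_def]; ring

theorem norm_nonneg (z : EisensteinInt) : 0 ≤ QuadraticAlgebra.norm z := by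
  rw [norm_eq]; nlinarith [sq_nonneg (2 * z.re - z.im), sq_nonneg z.im]

theorem norm_eq_zero {z : EisensteinInt} (h : QuadraticAlgebra.norm z = 0) : z = 0 := by
  rw [norm_eq] at h
  have him : z.im = 0 := by
    have : z.im ^ 2 = 0 := by
      nlinarith [sq_nonneg (2 * z.re - z.im), sq_nonneg z.im]
    exact pow_eq_zero_iff (two_ne_zero) |>.1 this
  have hre : z.re = 0 := by
    rw [him] at h
    exact pow_eq_zero_iff (two_ne_zero) |>.1 (by linarith : z.re ^ 2 = 0)
  exact QuadraticAlgebra.ext hre him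

instance : IsDomain EisensteinInt := by
  have : NoZeroDivisors EisensteinInt := ⟨by
    intro a b h
    have h2 : QuadraticAlgebra.norm a * QuadraticAlgebra.norm b = 0 := by
      rw [← map_mul, h, QuadraticAlgebra.norm_zero]
    exact (mul_eq_zero.1 h2).imp norm_eq_zero norm_eq_zero⟩
  exact NoZeroDivisors.to_isDomain _

/-- Division with remainder for the norm. -/
theorem exists_quotient (a b : EisensteinInt) (hb : b ≠ 0) :
    ∃ q : EisensteinInt, normNat (a - b * q) < normNat b := by
  have hN : 0 < QuadraticAlgebra.norm b :=
    lt_of_le_of_ne (norm_nonneg b) (fun h => hb (norm_eq_zero h.symm))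
  set n := QuadraticAlgebra.norm b with hn
  set t := a * star b with ht
  obtain ⟨q1, r1, e1, l1, u1⟩ : ∃ q r : ℤ, t.re = n * q + r ∧ -n ≤ 2 * r ∧ 2 * r ≤ n :=
    ⟨(2 * t.re + n) / (2 * n), t.re - n * ((2 * t.re + n) / (2 * n)), by ring, by
      nlinarith [Int.mul_ediv_self_le (x := 2 * t.re + n) (k := 2 * n) (by positivity)], by
      nlinarith [Int.lt_mul_ediv_self_add (x := 2 * t.re + n) (k := 2 * n) (by positivity)]⟩
  obtain ⟨q2, r2, e2, l2, u2⟩ : ∃ q r : ℤ, t.im = n * q + r ∧ -n ≤ 2 * r ∧ 2 * r ≤ n :=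
    ⟨(2 * t.im + n) / (2 * n), t.im - n * ((2 * t.im + n) / (2 * n)), by ring, by
      nlinarith [Int.mul_ediv_self_le (x := 2 * t.im + n) (k := 2 * n) (by positivity)], by
      nlinarith [Int.lt_mul_ediv_self_add (x := 2 * t.im + n) (k := 2 * n) (by positivity)]⟩
  refine ⟨⟨q1, q2⟩, ?_⟩
  have key : (a - b * ⟨q1, q2⟩) * star b = ⟨r1, r2⟩ := by
    have h1 : b * star b = ⟨n, 0⟩ := by
      rw [← QuadraticAlgebra.algebraMap_norm_eq_mul_star]; rfl
    have h2 : (a - b * ⟨q1, q2⟩) * star b = t - (b * star b) * ⟨q1, q2⟩ := by rw [ht]; ring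
    rw [h2, h1]
    ext
    · simp [e1]
    · simp [e2]
  have key2 : QuadraticAlgebra.norm (a - b * ⟨q1, q2⟩) * n = r1 ^ 2 - r1 * r2 + r2 ^ 2 := by
    have := congrArg QuadraticAlgebra.norm key
    rw [map_mul, QuadraticAlgebra.norm_star, norm_eq ⟨r1, r2⟩] at this
    exact this
  have hlt : QuadraticAlgebra.norm (a - b * ⟨q1, q2⟩) < n := by
    have : r1 ^ 2 - r1 * r2 + r2 ^ 2 < n * n := by
      nlinarith [mul_nonneg (by linarith : 0 ≤ n - 2 * r1) (by linarith : 0 ≤ n + 2 * r1),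
        mul_nonneg (by linarith : 0 ≤ n - 2 * r2) (by linarith : 0 ≤ n + 2 * r2),
        sq_nonneg (r1 + r2)]
    rw [← key2] at this
    exact lt_of_mul_lt_mul_right this hN.le
  have h0 := norm_nonneg (a - b * ⟨q1, q2⟩)
  unfold normNat
  omega

/-- Euclidean division makes `ℤ[ω]` a principal ideal ring, hence (by a Mathlib instance) a unique
factorization domain. -/
instance : IsPrincipalIdealRing EisensteinInt := by
  classical
  let E : EuclideanDomain EisensteinInt :=
    { (inferInstance : CommRing EisensteinInt), (inferInstance : Nontrivial EisensteinInt) with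
      quotient := fun a b => if h : b = 0 then 0 else (exists_quotient a b h).choose
      quotient_zero := fun a => by simp
      remainder := fun a b => a - b * (if h : b = 0 then 0 else (exists_quotient a b h).choose)
      quotient_mul_add_remainder_eq := fun a b => by ring
      r := fun a b => normNat a < normNat b
      r_wellFounded := (measure normNat).wf
      remainder_lt := fun a b hb => by
        simp only [hb, dif_neg, not_false_eq_true]
        exact (exists_quotient a b hb).choose_spec
      mul_left_not_lt := fun a b hb => by
        have h0 : normNat b ≠ 0 := fun h => hb (norm_eq_zero (Int.natAbs_eq_zero.1 h))
        simp only [normNat, map_mul, Int.natAbs_mul, not_lt]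
        exact Nat.le_mul_of_pos_right _ (Nat.pos_of_ne_zero h0) }
  exact @EuclideanDomain.to_principal_ideal_domain EisensteinInt E

open Classical in
/-- The cubic residue symbol `(α/π)₃` for a prime `π ∤ 3` of `ℤ[ω]`: it is `0` if `π ∣ α`, and
otherwise the unique `ω ^ j`, `j = 0, 1, 2`, with `α ^ ((N π - 1) / 3) ≡ ω ^ j (mod π)`. -/
noncomputable def cubicSymbolPrime (α π : EisensteinInt) : EisensteinInt :=
  if π ∣ α then 0
  else if π ∣ α ^ ((normNat π - 1) / 3) - 1 then 1
  else if π ∣ α ^ ((normNat π - 1) / 3) - omega then omega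
  else omega ^ 2

/-- The cubic residue symbol `(α/β)₃` for `β ∈ ℤ[ω]` coprime to `3`: the product of the `(α/π)₃`
over the prime factors `π` of `β`, counted with multiplicity (so it is `1` for a unit `β`). -/
noncomputable def cubicSymbol (α β : EisensteinInt) : EisensteinInt :=
  ((UniqueFactorizationMonoid.factors β).map (cubicSymbolPrime α)).prod

end EisensteinInt

/-- The set `𝒮_D` of the `u = A + B √D` with `A, B ∈ ℤ` such that the norm `A ^ 2 - B ^ 2 D` is a
cube, `u` is not a cube in the ring of integers of `ℚ(√D)` (realized as a subfield of `ℝ`), and no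
cube of a prime divides both `A` and `B`.  Here `A = u.re` and `B = u.im`. -/
noncomputable def cubicNormSet (D : ℤ) : Set (ℤ√D) :=
  {u | (∃ n : ℤ, u.norm = n ^ 3) ∧
    (¬ ∃ v : NumberField.RingOfIntegers (IntermediateField.adjoin ℚ {√(D : ℝ)}),
      ((v : IntermediateField.adjoin ℚ {√(D : ℝ)}) : ℝ) ^ 3 = (u.re : ℝ) + (u.im : ℝ) * √(D : ℝ)) ∧
    ∀ p : ℕ, p.Prime → ¬ ((p : ℤ) ^ 3 ∣ u.re ∧ (p : ℤ) ^ 3 ∣ u.im)}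

/-- `C(u)`: the product of the distinct odd primes that divide `A` and `B` but not `D`. -/
def oddCommonPart {D : ℤ} (u : ℤ√D) : ℤ :=
  ∏ p ∈ (Int.gcd u.re u.im).primeFactors.filter (fun p : ℕ => Odd p ∧ ¬ (p : ℤ) ∣ D), (p : ℤ)

theorem oddCommonPart_dvd_im {D : ℤ} (u : ℤ√D) : oddCommonPart u ∣ u.im := by
  have h : (∏ p ∈ (Int.gcd u.re u.im).primeFactors.filter (fun p : ℕ => Odd p ∧ ¬ (p : ℤ) ∣ D), p) ∣
      Int.gcd u.re u.im :=
    (Finset.prod_dvd_prod_of_subset _ _ _ (Finset.filter_subset _ _)).trans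
      (Nat.prod_primeFactors_dvd _)
  have h2 : oddCommonPart u ∣ (Int.gcd u.re u.im : ℤ) := by
    have h3 := Int.natCast_dvd_natCast.2 h
    rwa [Nat.cast_prod] at h3
  exact h2.trans (Int.gcd_dvd_right ..)

/-- `[a, 2b, c]` is a primitive integral binary quadratic form with `a > 0` and discriminant
`4d`, that is, `b ^ 2 - a c = d`. -/
def IsPrimitiveForm (d a b c : ℤ) : Prop :=
  0 < a ∧ Int.gcd a (Int.gcd (2 * b) c) = 1 ∧ b ^ 2 - a * c = d

/-- The value `f(x, y) = a x ^ 2 + 2 b x y + c y ^ 2`. -/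
def formValue (a b c x y : ℤ) : ℤ := a * x ^ 2 + 2 * b * x * y + c * y ^ 2

open EisensteinInt in
/-- `L = ((9 A y + (B / C) (a x + b y) (1 + 2 ω)) / f(x, y))₃`; the integer division `B / C` is
exact by `oddCommonPart_dvd_im`. -/
noncomputable def symbolL {D : ℤ} (u : ℤ√D) (a b c x y : ℤ) : EisensteinInt :=
  cubicSymbol
    (((9 * u.re * y : ℤ) : EisensteinInt) +
      ((u.im / oddCommonPart u * (a * x + b * y) : ℤ) : EisensteinInt) * (1 + 2 * omega))
    ((formValue a b c x y : ℤ) : EisensteinInt)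

open EisensteinInt in
/-- `R = ((9 A - (B / C) b (1 + 2 ω)) / a)₃`. -/
noncomputable def symbolR {D : ℤ} (u : ℤ√D) (a b : ℤ) : EisensteinInt :=
  cubicSymbol
    (((9 * u.re : ℤ) : EisensteinInt) -
      ((u.im / oddCommonPart u * b : ℤ) : EisensteinInt) * (1 + 2 * omega))
    ((a : ℤ) : EisensteinInt)

/-!
# Cubic residue symbols at values of binary quadratic forms

Put `X = a x + b y`, `Y = -3 C y` and `M = a f(x, y)`, so that `M = X ^ 2 + 3 D Y ^ 2`. All symbols
involved are over rational integers prime to `3`, where the symbols of rational integers and of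
`√-3` are trivial (`cubicSymbol_intCast`, `cubicSymbol_sqrtNegThree_intCast`). Multiplication by
`√-3 / C` turns `B X + A Y √-3` into the numerator of `L`, and modulo `a` the latter is `y` times
the conjugate of the numerator of `R`. Since conjugation inverts cube roots of unity, `L = R`
amounts to

  `((B X + A Y √-3) / M)₃ = 1`,

which is `cubicSymbol_eq_one_of_norm_eq_cube`. The reason for it is that the norm of
`B X + A Y √-3` is `B ^ 2 M + 3 Y ^ 2 n ^ 3`, where `n ^ 3 = A ^ 2 - D B ^ 2`. Let `β = r + s √-3`
be what remains of `B X + A Y √-3` after division by the common factors of its coordinates. By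
cubic reciprocity between `ℤ` and `ℤ[ω]` (`cubicSymbol_reciprocity`), `(β/M)₃` is `(M/β)₃` up to a
power of `(ω/M)₃`, and modulo `β` the norm expresses `M` by cubes, powers of `3` and squares of
integers `c` all of whose prime factors divide `r s`. For such a `c` the number `β` is, modulo each
prime factor of `c`, a rational integer or a rational multiple of `√-3`, so that `(β/c)₃ = 1`
(`cubicSymbol_add_mul_sqrtNegThree_eq_one`) and `(c/β)₃` is a power of `(ω/c)₃`. This gives a
relation between `(β/M)₃`, `(3/β)₃` and symbols of `ω` over rational integers
(`exists_cubicSymbol_relation`). To evaluate it one uses that `(ω/c)₃` depends only on `c ^ 2`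
modulo `9`, the congruence `s √-3 ≡ -r` modulo `β`, and `(3/β)₃ = 1` if `9 ∣ s`
(`cubicSymbol_three_add_mul_sqrtNegThree`). That the prime factors of a common factor of `A` and `B`
divide `r s` follows by comparing the valuations of `A ^ 2`, `D B ^ 2` and the cube `n ^ 3`
(`prime_dvd_mul_of_dvd_common_factor`): this is where cubefreeness and the factor `C` of `Y` enter.

Reciprocity is proved in the classical way. For a prime `π` of prime norm `p`, the cube of the Gauss
sum of the cubic character modulo `π` is `p J` with a Jacobi sum `J`, and `J = ± π` if `π` is
congruent to a rational integer modulo `3` (`associated_jacobiSum`, `three_dvd_im_jacobiSum`).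
Raising the Gauss sum to the power `q ^ 2` modulo a prime factor of `q` then compares `(π/q)₃` with
`(q/π)₃` (`dvd_mul_jacobiSum_pow_sub`).
-/

/-! ### Conjugation and norms in `ℤ[ω]` -/

namespace EisensteinInt

theorem omega_sq : omega ^ 2 = -1 - omega := by
  ext <;> simp [omega, pow_two, QuadraticAlgebra.re_one, QuadraticAlgebra.im_one]

theorem omega_pow_three : omega ^ 3 = 1 := by
  linear_combination (omega - 1) * omega_sq

theorem isUnit_omega : IsUnit omega :=
  IsUnit.of_mul_eq_one (omega ^ 2) (by rw [← omega_pow_three]; ring)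

/-- The square root `1 + 2ω = √-3` of `-3`. -/
def sqrtNegThree : EisensteinInt := 1 + 2 * omega

theorem sqrtNegThree_sq : sqrtNegThree ^ 2 = -3 := by
  unfold sqrtNegThree; linear_combination 4 * omega_sq

theorem star_omega : star omega = omega ^ 2 := by
  rw [omega_sq]; ext <;> simp [omega, QuadraticAlgebra.re_one, QuadraticAlgebra.im_one]

theorem star_sqrtNegThree : star sqrtNegThree = -sqrtNegThree := by
  unfold sqrtNegThree; rw [star_add, star_mul, star_omega, omega_sq]
  simp; ring

theorem isCoprime_of_isUnit_left {a b : EisensteinInt} (h : IsUnit a) : IsCoprime a b :=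
  isCoprime_one_left.of_isCoprime_of_dvd_left (isUnit_iff_dvd_one.1 h)

theorem normNat_mul (a b : EisensteinInt) : normNat (a * b) = normNat a * normNat b := by
  simp [normNat, Int.natAbs_mul]

theorem cast_normNat (a : EisensteinInt) : (normNat a : EisensteinInt) = a * star a := by
  rw [← QuadraticAlgebra.algebraMap_norm_eq_mul_star]
  have h : ((normNat a : ℕ) : ℤ) = QuadraticAlgebra.norm a := Int.natAbs_of_nonneg (norm_nonneg a)
  rw [← h]; simp

theorem normNat_ne_zero {a : EisensteinInt} (h : a ≠ 0) : normNat a ≠ 0 :=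
  fun h' => h (norm_eq_zero (Int.natAbs_eq_zero.1 h'))

theorem normNat_eq_one_iff {a : EisensteinInt} : normNat a = 1 ↔ IsUnit a := by
  rw [QuadraticAlgebra.isUnit_iff_norm_isUnit, Int.isUnit_iff_natAbs_eq]; rfl

theorem normNat_intCast (m : ℤ) : normNat (m : EisensteinInt) = m.natAbs ^ 2 := by
  simp [normNat, QuadraticAlgebra.norm_intCast, Int.natAbs_pow]

theorem card_quotient (a : EisensteinInt) :
    Nat.card (EisensteinInt ⧸ Ideal.span {a}) = normNat a := by
  have h := Ideal.absNorm_span_singleton a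
  rw [Ideal.absNorm_apply, Submodule.cardQuot_apply] at h
  rw [h, normNat, Algebra.norm_apply, ← QuadraticAlgebra.det_toLinearMap_eq_norm]
  rfl

theorem intCast_dvd_iff {a : ℤ} {z : EisensteinInt} :
    (a : EisensteinInt) ∣ z ↔ a ∣ z.re ∧ a ∣ z.im := by
  have := QuadraticAlgebra.algebraMap_dvd_iff (r := a) (z := z)
  rw [← this]; simp

theorem intCast_dvd_intCast {m n : ℤ} : (m : EisensteinInt) ∣ n ↔ m ∣ n := by
  rw [intCast_dvd_iff]; simp

end EisensteinInt

/-! ### The symbol modulo a prime -/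

namespace EisensteinInt

theorem sqrtNegThree_dvd_iff {z : EisensteinInt} : sqrtNegThree ∣ z ↔ (3 : ℤ) ∣ z.re + z.im := by
  constructor
  · rintro ⟨w, rfl⟩
    refine ⟨w.re - w.im, ?_⟩
    simp [sqrtNegThree, omega, two_mul, QuadraticAlgebra.re_one, QuadraticAlgebra.im_one]; ring
  · rintro ⟨k, hk⟩
    refine ⟨⟨z.im - k, z.im - 2 * k⟩, ?_⟩
    ext <;> simp [sqrtNegThree, omega, two_mul, QuadraticAlgebra.re_one, QuadraticAlgebra.im_one]
      <;> linarith

theorem cast_normNat_int (z : EisensteinInt) :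
    (normNat z : ℤ) = z.re ^ 2 - z.re * z.im + z.im ^ 2 := by
  rw [← norm_eq]; exact Int.natAbs_of_nonneg (norm_nonneg z)

theorem isCoprime_three_iff {z : EisensteinInt} : IsCoprime z 3 ↔ normNat z % 3 = 1 := by
  constructor
  · intro h
    have h1 : ¬ (3 : ℤ) ∣ z.re + z.im := by
      rw [← sqrtNegThree_dvd_iff]
      intro hd
      have h3 : sqrtNegThree ∣ 3 := ⟨-sqrtNegThree, by linear_combination sqrtNegThree_sq⟩
      have := normNat_eq_one_iff.2 (h.isUnit_of_dvd' hd h3)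
      revert this; decide
    have h2 : (z.re + z.im) ^ 2 % 3 = 1 := by
      have : (z.re + z.im) % 3 = 1 ∨ (z.re + z.im) % 3 = 2 := by omega
      rcases this with h | h <;> simp [pow_two, Int.mul_emod, h]
    have h3 : (normNat z : ℤ) = (z.re + z.im) ^ 2 - 3 * (z.re * z.im) := by
      rw [cast_normNat_int]; ring
    omega
  · intro h
    refine ⟨star z, -(normNat z / 3 : ℕ), ?_⟩
    have h1 : (normNat z : EisensteinInt) = ((3 * (normNat z / 3) + 1 : ℕ) : EisensteinInt) := by
      congr 1; omega
    rw [cast_normNat] at h1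
    push_cast at h1
    linear_combination h1

/-- The three cube roots of unity. -/
theorem eq_of_pow_three_eq_one {z : EisensteinInt} (h : z ^ 3 = 1) :
    z = 1 ∨ z = omega ∨ z = omega ^ 2 := by
  have : (z - 1) * ((z - omega) * (z - omega ^ 2)) = 0 := by
    linear_combination h - (z - 1) * z * omega_sq + (z - 1) * omega_pow_three
  simpa [sub_eq_zero] using this

/-- Distinct cube roots of unity stay distinct modulo a prime not dividing `3`. -/
theorem eq_of_dvd_sub {π z w : EisensteinInt} (hπ : ¬ IsUnit π) (h3 : IsCoprime π 3)
    (hz : z ^ 3 = 1) (hw : w ^ 3 = 1) (h : π ∣ z - w) : z = w := by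
  have key : z = w ∨ z - w ∣ 3 := by
    rcases eq_of_pow_three_eq_one hz with rfl | rfl | rfl <;>
    rcases eq_of_pow_three_eq_one hw with rfl | rfl | rfl
    · exact .inl rfl
    · exact .inr ⟨2 + omega, by linear_combination omega_sq⟩
    · exact .inr ⟨1 - omega, by linear_combination omega_sq - omega_pow_three⟩
    · exact .inr ⟨-2 - omega, by linear_combination omega_sq⟩
    · exact .inl rfl
    · exact .inr ⟨-1 - 2 * omega, by linear_combination omega_sq - 2 * omega_pow_three⟩
    · exact .inr ⟨omega - 1, by linear_combination omega_sq - omega_pow_three⟩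
    · exact .inr ⟨1 + 2 * omega, by linear_combination omega_sq - 2 * omega_pow_three⟩
    · exact .inl rfl
  exact key.resolve_right fun h' => hπ (h3.isUnit_of_dvd' dvd_rfl (h.trans h'))

/-- Fermat's little theorem modulo a prime of `ℤ[ω]`. -/
theorem dvd_pow_normNat_sub_one {α π : EisensteinInt} (hπ : Prime π) (h : ¬ π ∣ α) :
    π ∣ α ^ (normNat π - 1) - 1 := by
  have : (Ideal.span {π}).IsMaximal := by
    have : (Ideal.span {π}).IsPrime := (Ideal.span_singleton_prime hπ.ne_zero).2 hπ
    exact IsPrime.to_maximal_ideal (by simpa using hπ.ne_zero)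
  let _ : Field (EisensteinInt ⧸ Ideal.span {π}) := Ideal.Quotient.field _
  have hc := card_quotient π
  have : Finite (EisensteinInt ⧸ Ideal.span {π}) :=
    Nat.finite_of_card_ne_zero (by rw [hc]; exact normNat_ne_zero hπ.ne_zero)
  have := Fintype.ofFinite (EisensteinInt ⧸ Ideal.span {π})
  rw [← Ideal.mem_span_singleton, ← Ideal.Quotient.eq_zero_iff_mem, map_sub, map_pow, map_one,
    sub_eq_zero, ← hc, Nat.card_eq_fintype_card]
  refine FiniteField.pow_card_sub_one_eq_one _ ?_
  rwa [ne_eq, Ideal.Quotient.eq_zero_iff_mem, Ideal.mem_span_singleton]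

theorem cubicSymbolPrime_of_dvd {α π : EisensteinInt} (h : π ∣ α) : cubicSymbolPrime α π = 0 := by
  simp [cubicSymbolPrime, h]

theorem cubicSymbolPrime_spec {α π : EisensteinInt} (hπ : Prime π) (h3 : IsCoprime π 3)
    (h : ¬ π ∣ α) : cubicSymbolPrime α π ^ 3 = 1 ∧
      π ∣ α ^ ((normNat π - 1) / 3) - cubicSymbolPrime α π := by
  have hN := isCoprime_three_iff.1 h3
  set e := (normNat π - 1) / 3 with he
  have h1 := dvd_pow_normNat_sub_one hπ h
  rw [show normNat π - 1 = e * 3 by omega, pow_mul] at h1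
  have h2 : (α ^ e) ^ 3 - 1 = (α ^ e - 1) * ((α ^ e - omega) * (α ^ e - omega ^ 2)) := by
    generalize α ^ e = z
    linear_combination (z - 1) * z * omega_sq - (z - 1) * omega_pow_three
  rw [h2] at h1
  unfold cubicSymbolPrime
  rw [← he, if_neg h]
  split_ifs with ha hb
  · exact ⟨one_pow _, ha⟩
  · exact ⟨omega_pow_three, hb⟩
  · refine ⟨by linear_combination (omega ^ 3 + 1) * omega_pow_three, ?_⟩
    exact ((hπ.dvd_or_dvd h1).resolve_left ha |> hπ.dvd_or_dvd).resolve_left hb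

theorem cubicSymbolPrime_eq {α π z : EisensteinInt} (hπ : Prime π) (h3 : IsCoprime π 3)
    (hz : z ^ 3 = 1) (h : π ∣ α ^ ((normNat π - 1) / 3) - z) (h' : ¬ π ∣ α) :
    cubicSymbolPrime α π = z := by
  obtain ⟨h1, h2⟩ := cubicSymbolPrime_spec hπ h3 h'
  refine eq_of_dvd_sub hπ.not_isUnit h3 h1 hz ?_
  have := dvd_sub h h2
  rwa [sub_sub_sub_cancel_left] at this

theorem cubicSymbolPrime_mul {α β π : EisensteinInt} (hπ : Prime π) (h3 : IsCoprime π 3) :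
    cubicSymbolPrime (α * β) π = cubicSymbolPrime α π * cubicSymbolPrime β π := by
  by_cases ha : π ∣ α
  · rw [cubicSymbolPrime_of_dvd ha, cubicSymbolPrime_of_dvd (ha.mul_right _), zero_mul]
  by_cases hb : π ∣ β
  · rw [cubicSymbolPrime_of_dvd hb, cubicSymbolPrime_of_dvd (hb.mul_left _), mul_zero]
  obtain ⟨h1, h2⟩ := cubicSymbolPrime_spec hπ h3 ha
  obtain ⟨h4, h5⟩ := cubicSymbolPrime_spec hπ h3 hb
  refine cubicSymbolPrime_eq hπ h3 (by rw [mul_pow, h1, h4, one_mul]) ?_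
    (fun h => (hπ.dvd_or_dvd h).elim ha hb)
  rw [mul_pow]
  exact dvd_mul_sub_mul h2 h5

theorem cubicSymbolPrime_congr {α β π : EisensteinInt} (hπ : Prime π) (h3 : IsCoprime π 3)
    (h : π ∣ α - β) : cubicSymbolPrime α π = cubicSymbolPrime β π := by
  by_cases hb : π ∣ β
  · have ha : π ∣ α := by simpa using dvd_add h hb
    rw [cubicSymbolPrime_of_dvd hb, cubicSymbolPrime_of_dvd ha]
  have ha : ¬ π ∣ α := fun ha => hb (by simpa using dvd_sub ha h)
  obtain ⟨h4, h5⟩ := cubicSymbolPrime_spec hπ h3 hb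
  refine cubicSymbolPrime_eq hπ h3 h4 ?_ ha
  have := dvd_add (h.trans (sub_dvd_pow_sub_pow α β ((normNat π - 1) / 3))) h5
  simpa using this

theorem cubicSymbolPrime_associated {α π ρ : EisensteinInt} (h : Associated π ρ) :
    cubicSymbolPrime α π = cubicSymbolPrime α ρ := by
  have hN : normNat π = normNat ρ := by
    obtain ⟨u, rfl⟩ := h
    rw [normNat_mul, normNat_eq_one_iff.2 u.isUnit, mul_one]
  unfold cubicSymbolPrime
  have hd : ∀ c, π ∣ c ↔ ρ ∣ c := fun c => h.dvd_iff_dvd_left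
  rw [hN]
  congr 1
  · exact propext (hd _)
  · congr 1
    · exact propext (hd _)
    · congr 1
      exact propext (hd _)

theorem star_dvd_star {a b : EisensteinInt} : star a ∣ star b ↔ a ∣ b :=
  ⟨fun ⟨c, h⟩ => ⟨star c, by rw [← star_star b, h, star_mul, star_star, mul_comm]⟩,
    fun ⟨c, h⟩ => ⟨star c, by rw [h, star_mul, mul_comm]⟩⟩

theorem normNat_star (a : EisensteinInt) : normNat (star a) = normNat a := by
  simp only [normNat, QuadraticAlgebra.norm_star]

theorem prime_star {π : EisensteinInt} (h : Prime π) : Prime (star π) :=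
  (MulEquiv.prime_iff (starMulAut (R := EisensteinInt))).2 h

theorem isCoprime_star_three {π : EisensteinInt} (h : IsCoprime π 3) : IsCoprime (star π) 3 := by
  rwa [isCoprime_three_iff, normNat_star, ← isCoprime_three_iff]

theorem cubicSymbolPrime_star {α π : EisensteinInt} (hπ : Prime π) (h3 : IsCoprime π 3) :
    cubicSymbolPrime (star α) (star π) = star (cubicSymbolPrime α π) := by
  by_cases ha : π ∣ α
  · rw [cubicSymbolPrime_of_dvd ha, cubicSymbolPrime_of_dvd (star_dvd_star.2 ha), star_zero]
  obtain ⟨h4, h5⟩ := cubicSymbolPrime_spec hπ h3 ha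
  refine cubicSymbolPrime_eq (prime_star hπ) (isCoprime_star_three h3) ?_ ?_
    (fun h => ha (star_dvd_star.1 h))
  · rw [← star_pow, h4, star_one]
  · rwa [normNat_star, ← star_pow, ← star_sub, star_dvd_star]

theorem cubicSymbolPrime_omega {π : EisensteinInt} (hπ : Prime π) (h3 : IsCoprime π 3) :
    cubicSymbolPrime omega π = omega ^ ((normNat π - 1) / 3) := by
  refine cubicSymbolPrime_eq hπ h3 ?_ (by simp) ?_
  · rw [← pow_mul, mul_comm, pow_mul, omega_pow_three, one_pow]
  · intro h
    exact hπ.not_isUnit (isUnit_of_dvd_one (h.trans ⟨omega ^ 2, by rw [← omega_pow_three]; ring⟩))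

end EisensteinInt

/-! ### The symbol modulo a product of primes -/

namespace EisensteinInt
open UniqueFactorizationMonoid

theorem prod_map_cubicSymbolPrime_eq_of_rel {α : EisensteinInt} {s t : Multiset EisensteinInt}
    (h : Multiset.Rel Associated s t) :
    (s.map (cubicSymbolPrime α)).prod = (t.map (cubicSymbolPrime α)).prod := by
  have h2 : Multiset.Rel Eq (s.map (cubicSymbolPrime α)) (t.map (cubicSymbolPrime α)) :=
    Multiset.rel_map.2 (h.mono fun a _ b _ hab => cubicSymbolPrime_associated hab)
  rw [Multiset.rel_eq] at h2
  rw [h2]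

theorem cubicSymbol_mul_right {α β γ : EisensteinInt} (hβ : β ≠ 0) (hγ : γ ≠ 0) :
    cubicSymbol α (β * γ) = cubicSymbol α β * cubicSymbol α γ := by
  unfold cubicSymbol
  rw [prod_map_cubicSymbolPrime_eq_of_rel (factors_mul hβ hγ), Multiset.map_add, Multiset.prod_add]

theorem cubicSymbol_of_isUnit {α β : EisensteinInt} (h : IsUnit β) : cubicSymbol α β = 1 := by
  simp [cubicSymbol, factors_of_isUnit h]

theorem cubicSymbol_prime {α π : EisensteinInt} (h : Prime π) :
    cubicSymbol α π = cubicSymbolPrime α π := by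
  obtain ⟨p, hp, hf⟩ := factors_eq_singleton_of_irreducible h.irreducible
  simp [cubicSymbol, hf, cubicSymbolPrime_associated hp]

theorem ne_zero_of_isCoprime_three {β : EisensteinInt} (h : IsCoprime β 3) : β ≠ 0 := by
  rintro rfl
  have := isCoprime_three_iff.1 h
  revert this; decide

/-- Induction over the elements of `ℤ[ω]` that are coprime to `3`. -/
theorem induction_isCoprime_three {P : (β : EisensteinInt) → IsCoprime β 3 → Prop}
    (hu : ∀ ε (h : IsCoprime ε 3), IsUnit ε → P ε h)
    (hp : ∀ π γ, Prime π → ∀ (h : IsCoprime π 3) (h' : IsCoprime γ 3), P γ h' →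
      P (π * γ) (h.mul_left h'))
    (β : EisensteinInt) (h3 : IsCoprime β 3) : P β h3 := by
  induction β using induction_on_prime with
  | h₁ => exact absurd rfl (ne_zero_of_isCoprime_three h3)
  | h₂ x hx => exact hu x h3 hx
  | h₃ a p ha hpp ih =>
    exact hp p a hpp h3.of_mul_left_left h3.of_mul_left_right (ih h3.of_mul_left_right)

theorem cubicSymbol_mul_prime {α π γ : EisensteinInt} (hπ : Prime π) (h : IsCoprime γ 3) :
    cubicSymbol α (π * γ) = cubicSymbolPrime α π * cubicSymbol α γ := by
  rw [cubicSymbol_mul_right hπ.ne_zero (ne_zero_of_isCoprime_three h), cubicSymbol_prime hπ]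

theorem cubicSymbol_mul_left {α α' β : EisensteinInt} (h3 : IsCoprime β 3) :
    cubicSymbol (α * α') β = cubicSymbol α β * cubicSymbol α' β := by
  induction β, h3 using induction_isCoprime_three with
  | hu ε _ h => simp [cubicSymbol_of_isUnit h]
  | hp π γ hπ h h' ih =>
    simp only [cubicSymbol_mul_prime hπ h', ih, cubicSymbolPrime_mul hπ h]; ring

theorem cubicSymbol_congr {α α' β : EisensteinInt} (h3 : IsCoprime β 3) (hd : β ∣ α - α') :
    cubicSymbol α β = cubicSymbol α' β := by
  induction β, h3 using induction_isCoprime_three with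
  | hu ε _ h => simp [cubicSymbol_of_isUnit h]
  | hp π γ hπ h h' ih =>
    simp only [cubicSymbol_mul_prime hπ h', ih (dvd_of_mul_left_dvd hd),
      cubicSymbolPrime_congr hπ h (dvd_of_mul_right_dvd hd)]

theorem cubicSymbol_pow_three {α β : EisensteinInt} (h3 : IsCoprime β 3) (h : IsCoprime α β) :
    cubicSymbol α β ^ 3 = 1 := by
  induction β, h3 using induction_isCoprime_three with
  | hu ε _ hε => simp [cubicSymbol_of_isUnit hε]
  | hp π γ hπ h1 h' ih =>
    have hd : ¬ π ∣ α := fun hd => hπ.not_isUnit (h.of_mul_right_left.isUnit_of_dvd' hd dvd_rfl)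
    rw [cubicSymbol_mul_prime hπ h', mul_pow, ih h.of_mul_right_right,
      (cubicSymbolPrime_spec hπ h1 hd).1, one_mul]

theorem cubicSymbol_star {α β : EisensteinInt} (h3 : IsCoprime β 3) :
    cubicSymbol (star α) (star β) = star (cubicSymbol α β) := by
  induction β, h3 using induction_isCoprime_three with
  | hu ε _ h =>
    rw [cubicSymbol_of_isUnit h, cubicSymbol_of_isUnit h.star, star_one]
  | hp π γ hπ h h' ih =>
    rw [cubicSymbol_mul_prime hπ h', star_mul', star_mul',
      cubicSymbol_mul_prime (prime_star hπ) (isCoprime_star_three h'), ih,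
      cubicSymbolPrime_star hπ h]

theorem cubicSymbol_omega {β : EisensteinInt} (h3 : IsCoprime β 3) :
    cubicSymbol omega β = omega ^ ((normNat β - 1) / 3) := by
  induction β, h3 using induction_isCoprime_three with
  | hu ε _ h => rw [cubicSymbol_of_isUnit h, normNat_eq_one_iff.2 h]; simp
  | hp π γ hπ h h' ih =>
    rw [cubicSymbol_mul_prime hπ h', ih, cubicSymbolPrime_omega hπ h, ← pow_add, normNat_mul]
    have h1 := isCoprime_three_iff.1 h
    have h2 := isCoprime_three_iff.1 h'
    obtain ⟨a, ha⟩ : ∃ a, normNat π = 3 * a + 1 := ⟨normNat π / 3, by omega⟩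
    obtain ⟨b, hb⟩ : ∃ b, normNat γ = 3 * b + 1 := ⟨normNat γ / 3, by omega⟩
    have e : (3 * a + 1) * (3 * b + 1) - 1 = 3 * (3 * (a * b) + (a + b)) := by
      rw [show (3 * a + 1) * (3 * b + 1) = 3 * (3 * (a * b) + (a + b)) + 1 by ring]; rfl
    rw [ha, hb, e, Nat.mul_div_cancel_left _ (by norm_num), pow_add _ (3 * _), pow_mul,
      omega_pow_three, one_pow, one_mul]
    congr 1
    omega

theorem cubicSymbol_one {β : EisensteinInt} (h3 : IsCoprime β 3) : cubicSymbol 1 β = 1 := by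
  induction β, h3 using induction_isCoprime_three with
  | hu ε _ h => simp [cubicSymbol_of_isUnit h]
  | hp π γ hπ h h' ih =>
    rw [cubicSymbol_mul_prime hπ h', ih, mul_one]
    exact cubicSymbolPrime_eq hπ h (one_pow _) (by simp)
      (fun h => hπ.not_isUnit (isUnit_of_dvd_one h))

theorem cubicSymbol_pow {α β : EisensteinInt} (h3 : IsCoprime β 3) (n : ℕ) :
    cubicSymbol (α ^ n) β = cubicSymbol α β ^ n := by
  induction n with
  | zero => simp [cubicSymbol_one h3]
  | succ n ih => rw [pow_succ, cubicSymbol_mul_left h3, ih, pow_succ]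

theorem cubicSymbol_neg {α β : EisensteinInt} (h3 : IsCoprime β 3) :
    cubicSymbol (-α) β = cubicSymbol α β := by
  rw [← neg_one_mul, cubicSymbol_mul_left h3, show (-1 : EisensteinInt) = (-1) ^ 3 by norm_num,
    cubicSymbol_pow h3, cubicSymbol_pow_three h3 (by simpa using isCoprime_one_left.neg_left),
    one_mul]

theorem isCoprime_intCast {m n : ℤ} :
    IsCoprime (m : EisensteinInt) (n : EisensteinInt) ↔ IsCoprime m n := by
  refine ⟨fun h => ?_, fun h => by simpa using h.map (Int.castRingHom EisensteinInt)⟩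
  rw [Int.isCoprime_iff_gcd_eq_one]
  have h1 : ((Int.gcd m n : ℤ) : EisensteinInt) ∣ m := intCast_dvd_intCast.2 (Int.gcd_dvd_left ..)
  have h2 : ((Int.gcd m n : ℤ) : EisensteinInt) ∣ n := intCast_dvd_intCast.2 (Int.gcd_dvd_right ..)
  have h3 := (h.isUnit_of_dvd' h1 h2).dvd (a := 1)
  have h4 : (Int.gcd m n : ℤ) ∣ 1 := intCast_dvd_intCast.1 (by simpa using h3)
  have := Int.natCast_dvd_natCast.1 (by simpa using h4 : ((Int.gcd m n : ℕ) : ℤ) ∣ ((1 : ℕ) : ℤ))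
  simpa using this

theorem isCoprime_intCast_three {n : ℤ} : IsCoprime (n : EisensteinInt) 3 ↔ IsCoprime n 3 := by
  have := isCoprime_intCast (m := n) (n := 3)
  simpa using this

/-- A cube root of unity fixed by conjugation is `1`. -/
theorem eq_one_of_star_eq {z : EisensteinInt} (h : z ^ 3 = 1) (hs : star z = z) : z = 1 := by
  rcases eq_of_pow_three_eq_one h with rfl | rfl | rfl
  · rfl
  · revert hs; decide
  · revert hs; decide

theorem star_eq_sq {z : EisensteinInt} (h : z ^ 3 = 1) : star z = z ^ 2 := by
  rcases eq_of_pow_three_eq_one h with rfl | rfl | rfl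
  · simp
  · exact star_omega
  · rw [star_pow, star_omega]

/-- The symbol of two coprime rational integers is trivial, being invariant under conjugation. -/
theorem cubicSymbol_intCast {m n : ℤ} (h3 : IsCoprime n 3) (h : IsCoprime m n) :
    cubicSymbol (m : EisensteinInt) (n : EisensteinInt) = 1 := by
  have h3' := isCoprime_intCast_three.2 h3
  refine eq_one_of_star_eq (cubicSymbol_pow_three h3' (isCoprime_intCast.2 h)) ?_
  rw [← cubicSymbol_star h3', star_intCast, star_intCast]

/-- The symbol `(√-3/n)₃` is trivial: its square is `(-3/n)₃ = 1`. -/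
theorem cubicSymbol_sqrtNegThree_intCast {n : ℤ} (h3 : IsCoprime n 3) :
    cubicSymbol sqrtNegThree (n : EisensteinInt) = 1 := by
  have h3' := isCoprime_intCast_three.2 h3
  have h1 : cubicSymbol sqrtNegThree (n : EisensteinInt) ^ 2 = 1 := by
    rw [← cubicSymbol_pow h3', sqrtNegThree_sq, cubicSymbol_neg h3']
    simpa using cubicSymbol_intCast h3 h3.symm
  have h2 : cubicSymbol sqrtNegThree (n : EisensteinInt) ^ 3 = 1 := by
    refine cubicSymbol_pow_three h3' ?_
    refine IsCoprime.of_isCoprime_of_dvd_left h3'.symm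
      ⟨-sqrtNegThree, by linear_combination sqrtNegThree_sq⟩
  rw [pow_succ, h1, one_mul] at h2
  exact h2

end EisensteinInt

/-! ### Primes, Gauss sums and Jacobi sums -/

namespace EisensteinInt

theorem prime_of_normNat_prime {z : EisensteinInt} (h : (normNat z).Prime) : Prime z := by
  refine Irreducible.prime ⟨fun hu => h.one_lt.ne' (normNat_eq_one_iff.2 hu), fun a b hab => ?_⟩
  rw [hab, normNat_mul, Nat.prime_mul_iff] at h
  rcases h with ⟨-, h⟩ | ⟨-, h⟩
  · exact .inr (normNat_eq_one_iff.1 h)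
  · exact .inl (normNat_eq_one_iff.1 h)

theorem normNat_natCast (n : ℕ) : normNat (n : EisensteinInt) = n ^ 2 := by
  simpa using normNat_intCast (n : ℤ)

/-- A prime dividing a rational prime `q` has norm `q`, or is associated to `q`. -/
theorem normNat_eq_or_associated {π : EisensteinInt} (hπ : Prime π) {q : ℕ} (hq : q.Prime)
    (h : π ∣ q) : normNat π = q ∨ Associated π q := by
  obtain ⟨σ, hσ⟩ := h
  have h1 : normNat π * normNat σ = q ^ 2 := by rw [← normNat_mul, ← hσ, normNat_natCast]
  obtain ⟨i, hi, hi'⟩ := (Nat.dvd_prime_pow hq).1 (Dvd.intro _ h1)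
  interval_cases i
  · exact absurd (normNat_eq_one_iff.1 hi') hπ.not_isUnit
  · exact .inl (by simpa using hi')
  · right
    have : normNat σ = 1 := by
      rw [hi'] at h1
      exact Nat.eq_of_mul_eq_mul_left (pow_pos hq.pos 2) (by rw [h1, mul_one])
    rw [hσ]
    exact associated_mul_unit_right _ _ (normNat_eq_one_iff.1 this)

theorem exists_natPrime_dvd {π : EisensteinInt} (hπ : Prime π) :
    ∃ q : ℕ, q.Prime ∧ π ∣ (q : EisensteinInt) := by
  have h1 : π ∣ (normNat π : EisensteinInt) := ⟨star π, cast_normNat π⟩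
  have h2 : ∀ n : ℕ, n ≠ 0 → π ∣ (n : EisensteinInt) →
      ∃ q : ℕ, q.Prime ∧ π ∣ (q : EisensteinInt) := by
    intro n
    induction n using induction_on_primes with
    | zero => intro h; exact absurd rfl h
    | one => intro _ h; exact absurd (isUnit_of_dvd_one (by simpa using h)) hπ.not_isUnit
    | prime_mul p a hp ih =>
      intro h0 h
      rw [Nat.cast_mul] at h
      rcases hπ.dvd_or_dvd h with h | h
      · exact ⟨p, hp, h⟩
      · exact ih (right_ne_zero_of_mul h0) h
  exact h2 _ (normNat_ne_zero hπ.ne_zero) h1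

/-- A prime of prime norm `p` divides a rational integer only if `p` does. -/
theorem dvd_intCast_iff {π : EisensteinInt} (hp : (normNat π).Prime) {m : ℤ} :
    π ∣ (m : EisensteinInt) ↔ (normNat π : ℤ) ∣ m := by
  constructor
  · rintro ⟨c, hc⟩
    have h1 : normNat π ∣ m.natAbs ^ 2 := ⟨normNat c, by rw [← normNat_intCast, hc, normNat_mul]⟩
    exact Int.natCast_dvd.2 (hp.dvd_of_dvd_pow h1)
  · intro h
    have h1 : π ∣ (normNat π : EisensteinInt) := ⟨star π, cast_normNat π⟩
    refine h1.trans ?_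
    simpa using intCast_dvd_intCast.2 h

section Character
variable {p : ℕ} [hp : Fact p.Prime] {π : EisensteinInt}

/-- The cubic residue character modulo a prime `π` of prime norm `p`, as a multiplicative character
of `𝔽_p ≃ ℤ[ω]/π` with values in `ℤ[ω]`. -/
noncomputable def cubicCharacter (hN : normNat π = p) (h3 : IsCoprime π 3) :
    MulChar (ZMod p) EisensteinInt where
  toFun t := cubicSymbolPrime (t.val : EisensteinInt) π
  map_one' := by
    have hπ : Prime π := prime_of_normNat_prime (hN ▸ hp.1)
    have : Fact (1 < p) := ⟨hp.1.one_lt⟩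
    rw [ZMod.val_one, Nat.cast_one, ← cubicSymbol_prime hπ, cubicSymbol_one h3]
  map_mul' s t := by
    have hπ : Prime π := prime_of_normNat_prime (hN ▸ hp.1)
    rw [← cubicSymbolPrime_mul hπ h3]
    refine cubicSymbolPrime_congr hπ h3 ?_
    have := (dvd_intCast_iff (hN ▸ hp.1) (m := ((s * t).val : ℤ) - s.val * t.val)).2 ?_
    · simpa using this
    · rw [hN, ← ZMod.intCast_zmod_eq_zero_iff_dvd]
      simp
  map_nonunit' t ht := by
    have : t = 0 := by_contra fun h => ht (isUnit_iff_ne_zero.2 h)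
    subst this
    exact cubicSymbolPrime_of_dvd (by simp)

variable (hN : normNat π = p) (h3 : IsCoprime π 3)

theorem cubicCharacter_intCast (m : ℤ) :
    cubicCharacter hN h3 (m : ZMod p) = cubicSymbolPrime (m : EisensteinInt) π := by
  have hπ : Prime π := prime_of_normNat_prime (hN ▸ hp.1)
  refine cubicSymbolPrime_congr hπ h3 ?_
  have := (dvd_intCast_iff (hN ▸ hp.1) (m := ((m : ZMod p).val : ℤ) - m)).2 ?_
  · simpa using this
  · rw [hN, ← ZMod.intCast_zmod_eq_zero_iff_dvd]
    simp

theorem cubicCharacter_pow_three_apply {t : ZMod p} (ht : t ≠ 0) :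
    cubicCharacter hN h3 t ^ 3 = 1 := by
  have hπ : Prime π := prime_of_normNat_prime (hN ▸ hp.1)
  refine (cubicSymbolPrime_spec hπ h3 ?_).1
  have := (dvd_intCast_iff (hN ▸ hp.1 : (normNat π).Prime) (m := (t.val : ℤ))).not.2 ?_
  · simpa using this
  · rw [hN, ← ZMod.intCast_zmod_eq_zero_iff_dvd]
    simpa using ht

theorem cubicCharacter_pow_three : cubicCharacter hN h3 ^ 3 = 1 := by
  refine MulChar.ext fun t => ?_
  rw [MulChar.pow_apply_coe, cubicCharacter_pow_three_apply hN h3 t.ne_zero]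
  simp

open Finset in
/-- The Jacobi sum of the cubic residue character modulo `π` is divisible by `π`: modulo `π` it is
the sum over `𝔽_p` of a polynomial of degree less than `p - 1`. -/
theorem dvd_jacobiSum :
    π ∣ jacobiSum (cubicCharacter hN h3) (cubicCharacter hN h3) := by
  have hπ : Prime π := prime_of_normNat_prime (hN ▸ hp.1)
  have hmod := (hN ▸ isCoprime_three_iff.1 h3 : p % 3 = 1)
  set e := (p - 1) / 3 with he
  have h2 : 2 * e < p - 1 := by have := hp.1.two_le; omega
  have h1 : ∀ t : ZMod p, π ∣ (t.val : EisensteinInt) ^ e - cubicCharacter hN h3 t := by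
    intro t
    by_cases ht : t = 0
    · subst ht
      have : e ≠ 0 := by have := hp.1.two_le; omega
      rw [MulChar.map_zero]
      simp [this]
    · have := (cubicSymbolPrime_spec (α := (t.val : EisensteinInt)) hπ h3 ?_).2
      · rwa [hN, ← he] at this
      · have := (dvd_intCast_iff (hN ▸ hp.1 : (normNat π).Prime) (m := (t.val : ℤ))).not.2 ?_
        · simpa using this
        · rw [hN, ← ZMod.intCast_zmod_eq_zero_iff_dvd]
          simpa using ht
  have hsum : ∑ t : ZMod p, t ^ e * (1 - t) ^ e = 0 := by
    have : ∀ t : ZMod p, t ^ e * (1 - t) ^ e =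
        ∑ m ∈ range (e + 1), (-1) ^ (e - m) * (e.choose m : ZMod p) * t ^ (e + (e - m)) := by
      intro t
      rw [sub_eq_add_neg, add_pow, mul_sum]
      refine sum_congr rfl fun m _ => ?_
      rw [neg_pow, pow_add]; ring
    simp_rw [this]
    rw [sum_comm]
    refine sum_eq_zero fun m hm => ?_
    rw [← mul_sum, FiniteField.sum_pow_lt_card_sub_one, mul_zero]
    rw [ZMod.card]; omega
  have h3' : π ∣ ∑ t : ZMod p, (t.val : EisensteinInt) ^ e * ((1 - t).val : EisensteinInt) ^ e := by
    have := (dvd_intCast_iff (hN ▸ hp.1 : (normNat π).Prime)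
      (m := ∑ t : ZMod p, (t.val : ℤ) ^ e * ((1 - t).val : ℤ) ^ e)).2 ?_
    · simpa using this
    · rw [hN, ← ZMod.intCast_zmod_eq_zero_iff_dvd]
      push_cast
      simpa using hsum
  rw [jacobiSum]
  refine (dvd_iff_dvd_of_dvd_sub ?_).1 h3'
  rw [← sum_sub_distrib]
  exact dvd_sum fun t _ => dvd_mul_sub_mul (h1 t) (h1 _)

theorem cubicCharacter_ne_one : cubicCharacter hN h3 ≠ 1 := by
  intro h
  have h1 := dvd_jacobiSum hN h3
  rw [h, jacobiSum_one_one, ZMod.card] at h1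
  have h2 := (dvd_intCast_iff (hN ▸ hp.1 : (normNat π).Prime) (m := (p : ℤ) - 2)).1
    (by simpa using h1)
  rw [hN, dvd_sub_right (dvd_refl _)] at h2
  have h4 := Int.natCast_dvd_natCast.1 (by exact_mod_cast h2 : ((p : ℕ) : ℤ) ∣ ((2 : ℕ) : ℤ))
  have h5 := (hN ▸ isCoprime_three_iff.1 h3 : p % 3 = 1)
  have := Nat.le_of_dvd (by norm_num) h4
  have := hp.1.two_le
  interval_cases p
  omega

theorem cubicCharacter_inv :
    (cubicCharacter hN h3)⁻¹ = (cubicCharacter hN h3).ringHomComp (starRingEnd EisensteinInt) := by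
  rw [inv_eq_iff_mul_eq_one]
  refine MulChar.ext fun t => ?_
  have := cubicCharacter_pow_three_apply hN h3 t.ne_zero
  rw [MulChar.coeToFun_mul, Pi.mul_apply, MulChar.ringHomComp_apply, starRingEnd_apply,
    star_eq_sq this, MulChar.one_apply_coe, ← this]
  ring

theorem normNat_jacobiSum :
    normNat (jacobiSum (cubicCharacter hN h3) (cubicCharacter hN h3)) = p := by
  set χ := cubicCharacter hN h3 with hχ
  let φ := algebraMap EisensteinInt (FractionRing EisensteinInt)
  have hφ : Function.Injective φ := IsFractionRing.injective _ _
  have h1 : χ ≠ 1 := cubicCharacter_ne_one hN h3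
  have h2 : χ * χ ≠ 1 := by
    intro h
    have := cubicCharacter_pow_three hN h3
    rw [pow_succ, pow_two, ← hχ, h, one_mul] at this
    exact h1 this
  have hz : CharZero (FractionRing EisensteinInt) := charZero_of_injective_algebraMap hφ
  have hc : ringChar (FractionRing EisensteinInt) ≠ ringChar (ZMod p) := by
    rw [ZMod.ringChar_zmod_n, ringChar.eq_zero]
    exact hp.1.ne_zero.symm
  have := jacobiSum_mul_jacobiSum_inv hc (χ := χ.ringHomComp φ) (φ := χ.ringHomComp φ)
    ((MulChar.ringHomComp_ne_one_iff hφ).2 h1) ((MulChar.ringHomComp_ne_one_iff hφ).2 h1)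
    (by rw [← MulChar.ringHomComp_mul]; exact (MulChar.ringHomComp_ne_one_iff hφ).2 h2)
  rw [MulChar.ringHomComp_inv, jacobiSum_ringHomComp, jacobiSum_ringHomComp, ← map_mul,
    cubicCharacter_inv, jacobiSum_ringHomComp, ZMod.card, ← map_natCast φ, hφ.eq_iff,
    starRingEnd_apply, ← cast_normNat] at this
  exact_mod_cast this

theorem isPrimitiveRoot_omega : IsPrimitiveRoot omega 3 := by
  have : orderOf omega = 3 := orderOf_eq_prime omega_pow_three (by decide)
  exact this ▸ IsPrimitiveRoot.orderOf omega

/-- The Jacobi sum is congruent to `-1`, hence to a rational integer, modulo `3`. -/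
theorem three_dvd_im_jacobiSum :
    3 ∣ (jacobiSum (cubicCharacter hN h3) (cubicCharacter hN h3)).im := by
  have hmod := (hN ▸ isCoprime_three_iff.1 h3 : p % 3 = 1)
  obtain ⟨z, -, hz⟩ := exists_jacobiSum_eq_neg_one_add (by norm_num)
    (cubicCharacter_pow_three hN h3) (cubicCharacter_pow_three hN h3)
    (by rw [ZMod.card]; omega) isPrimitiveRoot_omega
  have h1 : ((3 : ℤ) : EisensteinInt) ∣ z * (omega - 1) ^ 2 :=
    ⟨-omega * z, by push_cast; linear_combination z * omega_sq⟩
  rw [hz]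
  simpa [QuadraticAlgebra.im_one] using (intCast_dvd_iff.1 h1).2

/-- Every prime of prime norm `p ≠ 3` is, up to a unit, the Jacobi sum of its cubic residue
character. -/
theorem associated_jacobiSum :
    Associated π (jacobiSum (cubicCharacter hN h3) (cubicCharacter hN h3)) := by
  obtain ⟨w, hw⟩ := dvd_jacobiSum hN h3
  have h1 := normNat_jacobiSum hN h3
  rw [hw, normNat_mul, hN] at h1
  rw [hw]
  refine associated_mul_unit_right _ _ (normNat_eq_one_iff.1 ?_)
  exact Nat.eq_of_mul_eq_mul_left hp.1.pos (by rw [h1, mul_one])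

/-- The congruence behind reciprocity. In an extension of `ℤ[ω]/ρ` the cubic Gauss sum `g` satisfies
`g ^ 3 = p J` with the Jacobi sum `J`, while two applications of the Frobenius `z ↦ z ^ q` give
`g ^ (q ^ 2) = (q/π)₃ g`. -/
theorem dvd_mul_jacobiSum_pow_sub {q : ℕ} (hq : q.Prime) (hq3 : q ≠ 3) (hqp : q ≠ p)
    {ρ : EisensteinInt} (hρ : Prime ρ) (hρ3 : IsCoprime ρ 3) (hρq : ρ ∣ (q : EisensteinInt)) :
    ρ ∣ (p * jacobiSum (cubicCharacter hN h3) (cubicCharacter hN h3)) ^ ((q ^ 2 - 1) / 3) -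
      cubicSymbolPrime (q : EisensteinInt) π := by
  set χ := cubicCharacter hN h3 with hχ
  set J := jacobiSum χ χ with hJ
  have : (Ideal.span {ρ}).IsMaximal := by
    have : (Ideal.span {ρ}).IsPrime := (Ideal.span_singleton_prime hρ.ne_zero).2 hρ
    exact IsPrime.to_maximal_ideal (by simpa using hρ.ne_zero)
  let K := EisensteinInt ⧸ Ideal.span {ρ}
  let _ : Field K := Ideal.Quotient.field _
  have hqK : (q : K) = 0 := by
    have := Ideal.Quotient.eq_zero_iff_mem.2 (Ideal.mem_span_singleton.2 hρq)
    simpa using this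
  have : Fact q.Prime := ⟨hq⟩
  have hcharK : CharP K q := ringChar.of_eq (CharP.ringChar_of_prime_eq_zero hq hqK)
  have hne : ringChar K ≠ ringChar (ZMod p) := by
    rw [ringChar.eq K q, ZMod.ringChar_zmod_n]; exact hqp
  -- an additive character of `𝔽_p` with values in an extension `L` of the residue field of `ρ`
  let ψ := AddChar.FiniteField.primitiveChar (ZMod p) K hne
  let L := CyclotomicField ψ.n K
  have hcharL : CharP L q := charP_of_injective_algebraMap (algebraMap K L).injective q
  let φ : EisensteinInt →+* L := (algebraMap K L).comp (Ideal.Quotient.mk _)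
  have hφ : ∀ z, φ z = 0 ↔ ρ ∣ z := by
    intro z
    simp only [φ, RingHom.comp_apply, map_eq_zero]
    rw [Ideal.Quotient.eq_zero_iff_mem, Ideal.mem_span_singleton]
  have hχ3 : χ.ringHomComp φ ^ 3 = 1 := by
    rw [MulChar.ringHomComp_pow, cubicCharacter_pow_three, MulChar.ringHomComp_one]
  have hχ1 : χ.ringHomComp φ ≠ 1 := by
    intro h
    refine cubicCharacter_ne_one hN h3 (MulChar.ext fun t => ?_)
    have h1 := congrArg (fun f : MulChar (ZMod p) L => f t) h
    simp only [MulChar.ringHomComp_apply, MulChar.one_apply_coe] at h1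
    rw [MulChar.one_apply_coe]
    refine eq_of_dvd_sub hρ.not_isUnit hρ3 (cubicCharacter_pow_three_apply hN h3 t.ne_zero)
      (one_pow _) ?_
    rw [← hφ, map_sub, map_one, h1, sub_self]
  have hord : orderOf (χ.ringHomComp φ) = 3 := orderOf_eq_prime hχ3 hχ1
  set g := gaussSum (χ.ringHomComp φ) ψ.char with hg
  have hm1 : χ (-1) = 1 := by
    have h1 := cubicCharacter_intCast hN h3 (-1)
    have hπ : Prime π := prime_of_normNat_prime (hN ▸ hp.1)
    rw [← cubicSymbol_prime hπ] at h1
    simpa [cubicSymbol_neg h3, cubicSymbol_one h3] using h1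
  have hg3 : g ^ 3 = φ (p * J) := by
    have h1 := gaussSum_pow_eq_prod_jacobiSum (χ := χ.ringHomComp φ) (ψ := ψ.char)
      (by rw [hord]; norm_num) ψ.prim
    rw [hord] at h1
    simpa [hm1, jacobiSum_ringHomComp, ← hJ, ← hg] using h1
  have hpL : (p : L) ≠ 0 := by
    intro h
    rw [CharP.cast_eq_zero_iff L q, Nat.prime_dvd_prime_iff_eq hq hp.1] at h
    exact hqp h
  have hg0 : g ≠ 0 :=
    gaussSum_ne_zero_of_nontrivial (by rwa [ZMod.card]) hχ1 ψ.prim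
  have hq2 : q ^ 2 % 3 = 1 := by
    have : q % 3 = 1 ∨ q % 3 = 2 := by
      have : ¬ 3 ∣ q := fun h => hq3 ((Nat.prime_dvd_prime_iff_eq Nat.prime_three hq).1 h).symm
      omega
    rcases this with h | h <;> simp [Nat.pow_mod, h]
  obtain ⟨e, he⟩ : ∃ e, q ^ 2 = 3 * e + 1 := ⟨q ^ 2 / 3, by omega⟩
  have hgq : φ (χ (q : ZMod p)) ^ 2 * g ^ (q ^ 2) = g := by
    have h1 : g ^ (q ^ 2) =
        gaussSum (χ.ringHomComp φ) (ψ.char.mulShift ((q ^ 2 : ℕ) : ZMod p)) := by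
      rw [pow_two, pow_mul, hg, gaussSum_frob, gaussSum_frob, ← pow_mul, ← pow_mul, ← pow_two, he,
        pow_succ, pow_mul, hχ3, one_pow, one_mul, AddChar.pow_mulShift]
    have hu : ((q ^ 2 : ℕ) : ZMod p) ≠ 0 := by
      rw [ne_eq, ZMod.natCast_eq_zero_iff]
      exact fun h => hqp ((Nat.prime_dvd_prime_iff_eq hp.1 hq).1 (hp.1.dvd_of_dvd_pow h)).symm
    have h2 := gaussSum_mulShift (χ.ringHomComp φ) ψ.char (Units.mk0 _ hu)
    rw [Units.val_mk0, ← h1, MulChar.ringHomComp_apply] at h2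
    simpa using h2
  have hχq : χ (q : ZMod p) = cubicSymbolPrime (q : EisensteinInt) π := by
    simpa using cubicCharacter_intCast hN h3 q
  have hχq3 : φ (χ (q : ZMod p)) ^ 3 = 1 := by
    rw [← map_pow, cubicCharacter_pow_three_apply, map_one]
    rw [ne_eq, ZMod.natCast_eq_zero_iff]
    exact fun h => hqp ((Nat.prime_dvd_prime_iff_eq hp.1 hq).1 h).symm
  rw [← hφ, map_sub, map_pow, ← hg3, ← pow_mul, sub_eq_zero, ← hχq,
    show 3 * ((q ^ 2 - 1) / 3) = 3 * e by omega]
  have h5 : φ (χ (q : ZMod p)) ^ 2 * g ^ (3 * e) = 1 :=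
    mul_right_cancel₀ hg0 (by rw [one_mul, mul_assoc, ← pow_succ, ← he]; exact hgq)
  linear_combination φ (χ (q : ZMod p)) * h5 - g ^ (3 * e) * hχq3

end Character
end EisensteinInt

/-! ### Reciprocity with rational integers -/

namespace EisensteinInt

theorem isUnit_intCast_iff {n : ℤ} : IsUnit (n : EisensteinInt) ↔ IsUnit n := by
  rw [← normNat_eq_one_iff, normNat_intCast, Int.isUnit_iff_natAbs_eq]
  simp

/-- A symbol `(α/q)₃` with a rational prime `q` is determined by `α ^ ((q ^ 2 - 1) / 3)` modulo the
primes dividing `q`. In the split case `q = ρσ` the congruence gives `(α/ρ)₃ ^ 2 = z = (α/σ)₃ ^ 2`,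
so that the product of the two symbols is `z ^ 4 = z`. -/
theorem cubicSymbol_natPrime_eq {α z : EisensteinInt} {q : ℕ} (hq : q.Prime) (hq3 : q ≠ 3)
    (hz : z ^ 3 = 1) (hα : IsCoprime α (q : EisensteinInt))
    (h : ∀ ρ, Prime ρ → IsCoprime ρ 3 → ρ ∣ (q : EisensteinInt) → ρ ∣ α ^ ((q ^ 2 - 1) / 3) - z) :
    cubicSymbol α (q : EisensteinInt) = z := by
  have hq3' : IsCoprime (q : EisensteinInt) 3 := by
    have : IsCoprime (q : ℤ) 3 := by
      have := Nat.isCoprime_iff_coprime.2 ((Nat.coprime_primes hq Nat.prime_three).2 hq3)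
      simpa using this
    simpa using isCoprime_intCast_three.2 this
  have hnd : ∀ ρ, Prime ρ → ρ ∣ (q : EisensteinInt) → ¬ ρ ∣ α := fun ρ hρ h1 h2 =>
    hρ.not_isUnit (hα.isUnit_of_dvd' h2 h1)
  by_cases hqp : Prime (q : EisensteinInt)
  · rw [cubicSymbol_prime hqp]
    refine cubicSymbolPrime_eq hqp hq3' hz ?_ (hnd _ hqp dvd_rfl)
    rw [normNat_natCast]
    exact h _ hqp hq3' dvd_rfl
  · have hq0 : (q : EisensteinInt) ≠ 0 := by exact_mod_cast hq.ne_zero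
    have hqu : ¬ IsUnit (q : EisensteinInt) := by
      rw [← normNat_eq_one_iff, normNat_natCast]
      exact (Nat.one_lt_pow two_ne_zero hq.one_lt).ne'
    obtain ⟨ρ, hρi, σ, hσ⟩ := WfDvdMonoid.exists_irreducible_factor hqu hq0
    have hρ := hρi.prime
    have hN : normNat ρ = q := (normNat_eq_or_associated hρ hq ⟨σ, hσ⟩).resolve_right
      fun ha => hqp (ha.prime hρ)
    have hN' : normNat σ = q := by
      have h1 : normNat ρ * normNat σ = q ^ 2 := by rw [← normNat_mul, ← hσ, normNat_natCast]
      rw [hN, pow_two] at h1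
      exact Nat.eq_of_mul_eq_mul_left hq.pos h1
    have hσp := prime_of_normNat_prime (hN' ▸ hq)
    have hmod : q % 3 = 1 := hN ▸ isCoprime_three_iff.1 (hσ ▸ hq3').of_mul_left_left
    obtain ⟨k, hk⟩ : ∃ k, q = 3 * k + 1 := ⟨q / 3, by omega⟩
    have hexp : (q ^ 2 - 1) / 3 = k * (3 * k + 2) := by
      rw [hk, show (3 * k + 1) ^ 2 = 3 * (k * (3 * k + 2)) + 1 by ring]; omega
    have key : ∀ τ, Prime τ → IsCoprime τ 3 → τ ∣ (q : EisensteinInt) → normNat τ = q →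
        cubicSymbolPrime α τ = z ^ 2 := by
      intro τ hτ hτ3 hτq hτN
      obtain ⟨h1, h2⟩ := cubicSymbolPrime_spec hτ hτ3 (hnd _ hτ hτq)
      rw [hτN, show (q - 1) / 3 = k by omega] at h2
      set y := cubicSymbolPrime α τ
      have h3 := h _ hτ hτ3 hτq
      rw [hexp, pow_mul] at h3
      have h4 := h2.trans (sub_dvd_pow_sub_pow (α ^ k) y (3 * k + 2))
      have h5 : y ^ (3 * k + 2) = y ^ 2 := by rw [pow_add, pow_mul, h1, one_pow, one_mul]
      rw [h5] at h4
      have h6 : y ^ 2 = z := by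
        refine eq_of_dvd_sub hτ.not_isUnit hτ3 (by rw [← pow_mul, mul_comm, pow_mul, h1, one_pow])
          hz ?_
        simpa using dvd_sub h3 h4
      rw [← h6]; linear_combination (-y) * h1
    have hρ3 := (hσ ▸ hq3').of_mul_left_left
    have hσ3 := (hσ ▸ hq3').of_mul_left_right
    have e1 := key ρ hρ hρ3 ⟨σ, hσ⟩ hN
    have e2 := key σ hσp hσ3 ⟨ρ, by rw [hσ, mul_comm]⟩ hN'
    rw [hσ, cubicSymbol_mul_prime hρ hσ3, cubicSymbol_prime hσp, e1, e2]
    linear_combination z * hz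

/-- The units `u` of `ℤ[ω]` with `3 ∣ u.im` are `±1`. -/
theorem eq_one_or_neg_one {u : EisensteinInt} (hu : IsUnit u) (h : 3 ∣ u.im) : u = 1 ∨ u = -1 := by
  have h1 := cast_normNat_int u
  rw [normNat_eq_one_iff.2 hu] at h1
  obtain ⟨k, hk⟩ := h
  have hk0 : k = 0 := by
    rw [hk] at h1
    push_cast at h1
    by_contra hk0
    have : 0 < k ^ 2 := by positivity
    nlinarith [sq_nonneg (2 * u.re - 3 * k)]
  rw [hk0, mul_zero] at hk
  rw [hk] at h1
  have h2 : u.re ^ 2 = 1 := by push_cast at h1; linarith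
  rcases mul_self_eq_one_iff.1 ((pow_two _).symm.trans h2) with h3 | h3
  · left; ext <;> simp [h3, hk, QuadraticAlgebra.re_one, QuadraticAlgebra.im_one]
  · right; ext <;> simp [h3, hk, QuadraticAlgebra.re_one, QuadraticAlgebra.im_one]

theorem cubicSymbol_associated_right {α β γ : EisensteinInt} (hβ : β ≠ 0) (h : Associated β γ) :
    cubicSymbol α β = cubicSymbol α γ := by
  obtain ⟨u, rfl⟩ := h
  rw [cubicSymbol_mul_right hβ u.ne_zero, cubicSymbol_of_isUnit u.isUnit, mul_one]

theorem three_dvd_im_of_mul {a b : EisensteinInt} (ha : 3 ∣ a.im) (ha3 : IsCoprime a 3)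
    (hab : 3 ∣ (a * b).im) : 3 ∣ b.im := by
  have h1 : (3 : ℤ) ∣ a.re * b.im := by
    rw [QuadraticAlgebra.im_mul] at hab
    obtain ⟨k, hk⟩ := ha
    obtain ⟨l, hl⟩ := hab
    exact ⟨l - k * b.re + k * b.im, by rw [hk] at hl; linear_combination hl⟩
  refine (Int.prime_three.dvd_or_dvd h1).resolve_left fun h => ?_
  have h2 : ((3 : ℤ) : EisensteinInt) ∣ a := intCast_dvd_iff.2 ⟨h, ha⟩
  have h4 := ha3.isUnit_of_dvd' (by simpa using h2) dvd_rfl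
  have h5 : (3 : EisensteinInt) = ((3 : ℤ) : EisensteinInt) := by simp
  rw [h5, isUnit_intCast_iff] at h4
  revert h4; decide

/-- Every element coprime to `3` has a multiple by a power of `ω` that is congruent to a rational
integer modulo `3`. -/
theorem exists_omega_pow_mul_im {z : EisensteinInt} (h : IsCoprime z 3) :
    ∃ j : ℕ, 3 ∣ (omega ^ j * z).im := by
  have h1 : ¬ (3 : ℤ) ∣ z.re + z.im := by
    intro hd
    have h3 : sqrtNegThree ∣ 3 := ⟨-sqrtNegThree, by linear_combination sqrtNegThree_sq⟩
    have := normNat_eq_one_iff.2 (h.isUnit_of_dvd' (sqrtNegThree_dvd_iff.2 hd) h3)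
    revert this; decide
  by_cases h2 : (3 : ℤ) ∣ z.im
  · exact ⟨0, by simpa using h2⟩
  by_cases h3 : (3 : ℤ) ∣ z.re
  · refine ⟨2, ?_⟩
    rw [omega_sq]
    simp [omega, QuadraticAlgebra.re_one, QuadraticAlgebra.im_one]
    omega
  · refine ⟨1, ?_⟩
    simp only [pow_one, omega, QuadraticAlgebra.im_mul]
    have : z.re % 3 = 1 ∨ z.re % 3 = 2 := by omega
    have : z.im % 3 = 1 ∨ z.im % 3 = 2 := by omega
    omega

/-- Cubic reciprocity between a prime `π` with `3 ∣ π.im` and a rational prime. -/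
theorem cubicSymbol_prime_natPrime {π : EisensteinInt} (hπ : Prime π) (h3 : IsCoprime π 3)
    (him : 3 ∣ π.im) {q : ℕ} (hq : q.Prime) (hq3 : q ≠ 3) (hc : IsCoprime π (q : EisensteinInt)) :
    cubicSymbol π (q : EisensteinInt) = cubicSymbol (q : EisensteinInt) π := by
  have hq3z : IsCoprime (q : ℤ) 3 := by
    have := Nat.isCoprime_iff_coprime.2 ((Nat.coprime_primes hq Nat.prime_three).2 hq3)
    simpa using this
  have hq3' : IsCoprime (q : EisensteinInt) 3 := by simpa using isCoprime_intCast_three.2 hq3z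
  obtain ⟨p, hp, hd⟩ := exists_natPrime_dvd hπ
  have hqp : q ≠ p := by
    rintro rfl
    exact hπ.not_isUnit (hc.isUnit_of_dvd' dvd_rfl hd)
  have hpqz : IsCoprime (p : ℤ) (q : ℤ) :=
    Nat.isCoprime_iff_coprime.2 ((Nat.coprime_primes hp hq).2 hqp.symm)
  have hpq : cubicSymbol (p : EisensteinInt) (q : EisensteinInt) = 1 := by
    simpa using cubicSymbol_intCast hq3z hpqz
  rcases normNat_eq_or_associated hπ hp hd with hN | ⟨u, hu⟩
  · have : Fact p.Prime := ⟨hp⟩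
    set J := jacobiSum (cubicCharacter hN h3) (cubicCharacter hN h3) with hJ
    obtain ⟨u, hu⟩ := associated_jacobiSum hN h3
    rw [← hJ] at hu
    have hu1 := eq_one_or_neg_one u.isUnit
      (three_dvd_im_of_mul him h3 (hu ▸ three_dvd_im_jacobiSum hN h3))
    have hJq : cubicSymbol J (q : EisensteinInt) = cubicSymbol π (q : EisensteinInt) := by
      rw [← hu]
      rcases hu1 with h | h <;> rw [h]
      · rw [mul_one]
      · rw [mul_neg_one, cubicSymbol_neg hq3']
    have hcJ : IsCoprime J (q : EisensteinInt) := by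
      rw [← hu]
      exact IsCoprime.mul_left hc (isCoprime_of_isUnit_left u.isUnit)
    have hcp : IsCoprime (p : EisensteinInt) (q : EisensteinInt) := by
      simpa using isCoprime_intCast.2 hpqz
    have hnd : ¬ π ∣ (q : EisensteinInt) := fun h => hπ.not_isUnit (hc.isUnit_of_dvd' dvd_rfl h)
    have := cubicSymbol_natPrime_eq hq hq3 (cubicSymbolPrime_spec hπ h3 hnd).1 (hcp.mul_left hcJ)
      fun ρ hρ hρ3 hρq => dvd_mul_jacobiSum_pow_sub hN h3 hq hq3 hqp hρ hρ3 hρq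
    rw [cubicSymbol_mul_left hq3', hpq, one_mul, hJq] at this
    rw [this, cubicSymbol_prime hπ]
  · have hp3 : IsCoprime (p : ℤ) 3 := by
      rw [← isCoprime_intCast_three]
      have : IsCoprime (p : EisensteinInt) 3 := by
        rw [← hu]
        exact IsCoprime.mul_left h3 (isCoprime_of_isUnit_left u.isUnit)
      simpa using this
    have hu1 := eq_one_or_neg_one u.isUnit (three_dvd_im_of_mul him h3 (by rw [hu]; simp))
    have hπp : π = p ∨ π = -p := by
      rw [← hu]
      rcases hu1 with h | h <;> simp [h]
    have h1 : cubicSymbol π (q : EisensteinInt) = 1 := by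
      rcases hπp with h | h <;> rw [h]
      · exact hpq
      · rw [cubicSymbol_neg hq3', hpq]
    rw [h1, cubicSymbol_associated_right hπ.ne_zero ⟨u, hu⟩]
    symm
    simpa using cubicSymbol_intCast hp3 hpqz.symm

/-- **Cubic reciprocity** between a rational integer and an element of `ℤ[ω]` congruent to a
rational integer modulo `3`. -/
theorem cubicSymbol_reciprocity {γ : EisensteinInt} (h3 : IsCoprime γ 3) (him : 3 ∣ γ.im) {m : ℤ}
    (hm : IsCoprime m 3) (hc : IsCoprime γ (m : EisensteinInt)) :
    cubicSymbol γ (m : EisensteinInt) = cubicSymbol (m : EisensteinInt) γ := by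
  have hprime : ∀ q : ℕ, q.Prime → q ≠ 3 → ∀ β, IsCoprime β 3 → ∀ j : ℕ, 3 ∣ (omega ^ j * β).im →
      IsCoprime β (q : EisensteinInt) →
      cubicSymbol (omega ^ j * β) (q : EisensteinInt) =
        cubicSymbol (q : EisensteinInt) (omega ^ j * β) := by
    intro q hq hq3 β hβ
    have hq3' : IsCoprime (q : EisensteinInt) 3 := by
      have := Nat.isCoprime_iff_coprime.2 ((Nat.coprime_primes hq Nat.prime_three).2 hq3)
      have := (isCoprime_intCast_three (n := (q : ℤ))).2 (by simpa using this)
      simpa using this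
    induction β, hβ using induction_isCoprime_three with
    | hu ε _ hε =>
      intro j hj _
      have hu := (isUnit_omega.pow j).mul hε
      rw [cubicSymbol_of_isUnit hu]
      rcases eq_one_or_neg_one hu hj with h | h <;> rw [h]
      · exact cubicSymbol_one hq3'
      · rw [cubicSymbol_neg hq3', cubicSymbol_one hq3']
    | hp π β hπ hπ3 hβ3 ih =>
      intro j hj hc
      obtain ⟨i, hi⟩ := exists_omega_pow_mul_im hπ3
      have hui := isUnit_omega.pow i
      have hass : Associated π (omega ^ i * π) := (associated_unit_mul_left π _ hui).symm
      have hπ' := hass.prime hπ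
      have hπ3' : IsCoprime (omega ^ i * π) 3 :=
        (isCoprime_of_isUnit_left hui).mul_left hπ3
      have e : omega ^ j * (π * β) = (omega ^ i * π) * (omega ^ (j + 2 * i) * β) := by
        have : (omega ^ i) ^ 3 = 1 := by rw [← pow_mul, mul_comm, pow_mul, omega_pow_three, one_pow]
        rw [pow_add, mul_comm 2 i, pow_mul]
        linear_combination (-omega ^ j * π * β) * this
      rw [e] at hj ⊢
      have hj' := three_dvd_im_of_mul hi hπ3' hj
      have hcβ := hc.of_mul_left_right
      have hcπ : IsCoprime (omega ^ i * π) (q : EisensteinInt) :=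
        (isCoprime_of_isUnit_left hui).mul_left
          hc.of_mul_left_left
      rw [cubicSymbol_mul_left hq3', ih _ hj' hcβ,
        cubicSymbol_prime_natPrime hπ' hπ3' hi hq hq3 hcπ, ← cubicSymbol_mul_right hπ'.ne_zero]
      exact mul_ne_zero (isUnit_omega.pow _).ne_zero (ne_zero_of_isCoprime_three hβ3)
  have hnat : ∀ m : ℕ, IsCoprime (m : ℤ) 3 → IsCoprime γ (m : EisensteinInt) →
      cubicSymbol γ (m : EisensteinInt) = cubicSymbol (m : EisensteinInt) γ := by
    intro m
    induction m using induction_on_primes with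
    | zero =>
      intro h
      exact absurd h (by decide)
    | one => intro _ _; rw [Nat.cast_one, cubicSymbol_of_isUnit isUnit_one, cubicSymbol_one h3]
    | prime_mul p a hp ih =>
      intro h hc
      have ha0 : (a : EisensteinInt) ≠ 0 := by
        rintro h0
        have : a = 0 := by exact_mod_cast h0
        subst this
        exact absurd h (by simp; decide)
      rw [Nat.cast_mul] at h hc
      have hp3 : p ≠ 3 := by
        rintro rfl
        exact absurd h.of_mul_left_left (by decide)
      have h1 := hprime p hp hp3 γ h3 0 (by simpa using him) hc.of_mul_right_left
      rw [pow_zero, one_mul] at h1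
      rw [Nat.cast_mul, cubicSymbol_mul_right (by exact_mod_cast hp.ne_zero) ha0,
        cubicSymbol_mul_left h3, h1, ih h.of_mul_left_right hc.of_mul_right_right]
  obtain ⟨n, rfl | rfl⟩ := m.eq_nat_or_neg
  · simpa using hnat n hm (by simpa using hc)
  · have hn3 : IsCoprime (n : ℤ) 3 := (IsCoprime.neg_left_iff _ _).1 hm
    have hn0 : (n : EisensteinInt) ≠ 0 := by
      have := ne_zero_of_isCoprime_three (isCoprime_intCast_three.2 hn3)
      simpa using this
    rw [Int.cast_neg, Int.cast_natCast] at hc ⊢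
    rw [cubicSymbol_neg h3, ← hnat n hn3 (by simpa using hc.neg_right)]
    exact (cubicSymbol_associated_right hn0 ⟨-1, by simp⟩).symm

end EisensteinInt

/-! ### The symbols of `ω` and `3`, and of `p + q √-3` -/

namespace EisensteinInt

theorem isCoprime_three_int_iff {n : ℤ} : IsCoprime n 3 ↔ ¬ 3 ∣ n :=
  isCoprime_comm.trans (Int.prime_three.irreducible.coprime_iff_not_dvd)

theorem cubicSymbol_omega_pow_three {c : ℤ} (h : IsCoprime c 3) :
    cubicSymbol omega (c : EisensteinInt) ^ 3 = 1 :=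
  cubicSymbol_pow_three (isCoprime_intCast_three.2 h) (isCoprime_of_isUnit_left isUnit_omega)

theorem cubicSymbol_omega_mul {c d : ℤ} (hc : IsCoprime c 3) (hd : IsCoprime d 3) :
    cubicSymbol omega ((c * d : ℤ) : EisensteinInt) =
      cubicSymbol omega (c : EisensteinInt) * cubicSymbol omega (d : EisensteinInt) := by
  rw [Int.cast_mul, cubicSymbol_mul_right]
  · exact ne_zero_of_isCoprime_three (isCoprime_intCast_three.2 hc)
  · exact ne_zero_of_isCoprime_three (isCoprime_intCast_three.2 hd)

/-- The symbol `(ω/β)₃` depends only on the norm of `β` modulo `9`. -/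
theorem cubicSymbol_omega_congr {β γ : EisensteinInt} (hβ : IsCoprime β 3) (hγ : IsCoprime γ 3)
    (h : (9 : ℤ) ∣ normNat β - normNat γ) : cubicSymbol omega β = cubicSymbol omega γ := by
  rw [cubicSymbol_omega hβ, cubicSymbol_omega hγ]
  have h1 := isCoprime_three_iff.1 hβ
  have h2 := isCoprime_three_iff.1 hγ
  rw [← pow_mod_orderOf, ← pow_mod_orderOf omega ((normNat γ - 1) / 3),
    orderOf_eq_prime omega_pow_three (by decide)]
  congr 1
  omega

theorem cast_normNat_intCast (c : ℤ) : (normNat (c : EisensteinInt) : ℤ) = c ^ 2 := by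
  rw [normNat_intCast]; simp

theorem cubicSymbol_omega_intCast_congr {c d : ℤ} (hc : IsCoprime c 3) (hd : IsCoprime d 3)
    (h : 9 ∣ c ^ 2 - d ^ 2) :
    cubicSymbol omega (c : EisensteinInt) = cubicSymbol omega (d : EisensteinInt) :=
  cubicSymbol_omega_congr (isCoprime_intCast_three.2 hc) (isCoprime_intCast_three.2 hd)
    (by rwa [cast_normNat_intCast, cast_normNat_intCast])

/-- `(3/(a + bω))₃ = 1` for coprime `a, b` with `9 ∣ b`. The congruence
`(a + b) ω ≡ -a (1 - ω)` modulo `a + bω` turns `((1 - ω)/(a + bω))₃` into symbols of rational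
integers, which reciprocity evaluates; then `(1 - ω) ^ 2 = -3ω`. -/
theorem cubicSymbol_three_eq_one {a b : ℤ} (ha : IsCoprime a 3) (hb : 9 ∣ b)
    (hab : IsCoprime a b) : cubicSymbol 3 (a + b * omega) = 1 := by
  set β : EisensteinInt := a + b * omega with hβ
  have h3b : (3 : ℤ) ∣ b := dvd_trans (by norm_num) hb
  have hre : β.re = a := by simp [hβ, omega]
  have him : β.im = b := by simp [hβ, omega]
  have ha3 := isCoprime_intCast_three.2 ha
  have hβ3 : IsCoprime β 3 := by
    obtain ⟨c, hc⟩ := h3b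
    have : β = a + (c * omega) * 3 := by rw [hβ, hc]; push_cast; ring
    rw [this]
    exact IsCoprime.add_mul_right_left ha3 _
  have hs : IsCoprime (a + b) 3 := by
    obtain ⟨c, rfl⟩ := h3b
    exact IsCoprime.add_mul_left_left ha _
  have hs3 := isCoprime_intCast_three.2 hs
  have habE := isCoprime_intCast.2 hab
  have hcoa : IsCoprime β (a : EisensteinInt) := by
    have : IsCoprime (b * omega : EisensteinInt) a :=
      IsCoprime.mul_left habE.symm (isCoprime_of_isUnit_left isUnit_omega)
    have := this.add_mul_left_left 1
    rwa [mul_one, add_comm, ← hβ] at this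
  have h1ω : IsCoprime (1 - omega) ((a + b : ℤ) : EisensteinInt) :=
    hs3.symm.of_isCoprime_of_dvd_left ⟨2 + omega, by linear_combination omega_sq⟩
  have hcos : IsCoprime β ((a + b : ℤ) : EisensteinInt) := by
    have h1 : IsCoprime (a : EisensteinInt) ((a + b : ℤ) : EisensteinInt) := by
      rw [isCoprime_intCast]
      simpa [add_comm] using hab.add_mul_left_right 1
    have := (IsCoprime.mul_left h1 h1ω).add_mul_left_left omega
    have e : β = a * (1 - omega) + ((a + b : ℤ) : EisensteinInt) * omega := by
      rw [hβ]; push_cast; ring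
    rwa [e]
  obtain ⟨c, hc⟩ := hb
  have hw : ∀ z, IsCoprime z 3 → (9 : ℤ) ∣ normNat z - a ^ 2 →
      cubicSymbol omega z = cubicSymbol omega (a : EisensteinInt) := fun z hz h =>
    cubicSymbol_omega_congr hz ha3 (by rwa [cast_normNat_intCast])
  have hwβ := hw β hβ3 (by
    rw [cast_normNat_int, hre, him, hc]
    exact ⟨-a * c + 9 * c ^ 2, by ring⟩)
  have hws := hw ((a + b : ℤ) : EisensteinInt) hs3 (by
    rw [cast_normNat_intCast, hc]
    exact ⟨2 * a * c + 9 * c ^ 2, by ring⟩)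
  set w := cubicSymbol omega (a : EisensteinInt) with hwdef
  have hw3 : w ^ 3 = 1 := cubicSymbol_omega_pow_three ha
  have him3 : 3 ∣ β.im := by rw [him]; exact h3b
  have e1 : cubicSymbol (a : EisensteinInt) β = w := by
    rw [← cubicSymbol_reciprocity hβ3 him3 ha hcoa,
      cubicSymbol_congr ha3 (α' := b * omega) ⟨1, by rw [hβ]; ring⟩, cubicSymbol_mul_left ha3,
      cubicSymbol_intCast ha hab.symm, one_mul]
  have hsq : ∀ z, IsCoprime z 3 → cubicSymbol (1 - omega) z ^ 2 =
      cubicSymbol 3 z * cubicSymbol omega z := by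
    intro z hz
    rw [← cubicSymbol_pow hz, show (1 - omega) ^ 2 = -(3 * omega) by
      linear_combination omega_sq, cubicSymbol_neg hz, cubicSymbol_mul_left hz]
  have e2 : cubicSymbol ((a + b : ℤ) : EisensteinInt) β = w ^ 2 := by
    have h1 : cubicSymbol (1 - omega) ((a + b : ℤ) : EisensteinInt) ^ 2 = w := by
      rw [hsq _ hs3, hws]
      have : cubicSymbol 3 ((a + b : ℤ) : EisensteinInt) = 1 := by
        simpa using cubicSymbol_intCast hs hs.symm
      rw [this, one_mul]
    have h2 : cubicSymbol (1 - omega) ((a + b : ℤ) : EisensteinInt) ^ 3 = 1 :=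
      cubicSymbol_pow_three hs3 h1ω
    rw [← cubicSymbol_reciprocity hβ3 him3 hs hcos,
      cubicSymbol_congr hs3 (α' := a * (1 - omega)) ⟨omega, by rw [hβ]; push_cast; ring⟩,
      cubicSymbol_mul_left hs3, cubicSymbol_intCast hs, one_mul, ← h1]
    · linear_combination (-cubicSymbol (1 - omega) ((a + b : ℤ) : EisensteinInt)) * h2
    · simpa [add_comm] using hab.add_mul_left_right 1
  have e3 : cubicSymbol (1 - omega) β * w = w ^ 2 * w := by
    conv_lhs => rw [← e1, ← cubicSymbol_mul_left hβ3]
    rw [← e2, ← hwβ, ← cubicSymbol_mul_left hβ3, ← cubicSymbol_neg hβ3]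
    refine cubicSymbol_congr hβ3 ⟨-1, ?_⟩
    rw [hβ]; push_cast; ring
  have e4 := hsq β hβ3
  rw [hwβ] at e4
  have hwu : w ≠ 0 := by
    intro h
    rw [h] at hw3
    revert hw3; decide
  have e5 := mul_right_cancel₀ hwu e3
  rw [e5] at e4
  exact mul_right_cancel₀ hwu
    (show cubicSymbol 3 β * w = 1 * w by rw [← e4]; linear_combination w * hw3)

theorem normNat_add_mul_sqrtNegThree (p q : ℤ) :
    (normNat ((p : EisensteinInt) + q * sqrtNegThree) : ℤ) = p ^ 2 + 3 * q ^ 2 := by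
  rw [cast_normNat_int]
  simp [sqrtNegThree, omega, two_mul, QuadraticAlgebra.re_one, QuadraticAlgebra.im_one]
  ring

theorem isCoprime_add_mul_sqrtNegThree_three {p q : ℤ} (hp : IsCoprime p 3) :
    IsCoprime ((p : EisensteinInt) + q * sqrtNegThree) 3 := by
  rw [isCoprime_three_iff]
  have h1 := normNat_add_mul_sqrtNegThree p q
  have h2 := isCoprime_three_iff.1 (isCoprime_intCast_three.2 hp)
  have h3 := cast_normNat_intCast p
  omega

/-- The symbol `(3/(p + q √-3))₃` is trivial if `9 ∣ q`. -/
theorem cubicSymbol_three_add_mul_sqrtNegThree {p q : ℤ} (hp : IsCoprime p 3) (hq : 9 ∣ q)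
    (hpq : IsCoprime p q) : cubicSymbol 3 ((p : EisensteinInt) + q * sqrtNegThree) = 1 := by
  have e : (p : EisensteinInt) + q * sqrtNegThree = ((p + q : ℤ) : EisensteinInt) +
      ((2 * q : ℤ) : EisensteinInt) * omega := by
    unfold sqrtNegThree; push_cast; ring
  have hs3 : IsCoprime (p + q) 3 := by
    obtain ⟨c, rfl⟩ := hq
    have := IsCoprime.add_mul_left_left hp (3 * c)
    rwa [← mul_assoc] at this
  have hsq : IsCoprime (p + q) q := by simpa using hpq.add_mul_left_left 1
  by_cases h2 : (2 : ℤ) ∣ p + q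
  · -- here `p + q √-3 = (p + q) + 2 q ω` is divisible by `2`;
    -- otherwise its coordinates are coprime
    obtain ⟨d, hd⟩ := h2
    have hd3 : IsCoprime d 3 := (hd ▸ hs3).of_mul_left_right
    have e2 : (p : EisensteinInt) + q * sqrtNegThree =
        ((2 : ℤ) : EisensteinInt) * ((d : EisensteinInt) + q * omega) := by
      rw [e, hd]; push_cast; ring
    have hne := ne_zero_of_isCoprime_three (isCoprime_add_mul_sqrtNegThree_three (q := q) hp)
    rw [e2] at hne ⊢
    rw [cubicSymbol_mul_right (left_ne_zero_of_mul hne) (right_ne_zero_of_mul hne),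
      cubicSymbol_three_eq_one hd3 hq (hd ▸ hsq).of_mul_left_right, mul_one]
    simpa using cubicSymbol_intCast (m := 3) (n := 2) (by decide) (by decide)
  · rw [e]
    refine cubicSymbol_three_eq_one hs3 (hq.mul_left 2) ?_
    exact IsCoprime.mul_right
      ((Int.prime_two.irreducible.coprime_iff_not_dvd.2 h2).symm) hsq

/-- If every prime factor of `c` divides `p` or `q`, then `p + q √-3` is modulo each of them a
rational integer or a rational multiple of `√-3`, so that its symbol over `c` is trivial. -/
theorem cubicSymbol_add_mul_sqrtNegThree_eq_one {p q : ℤ} (hpq : IsCoprime p q) {c : ℤ}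
    (hc : IsCoprime c 3) (h : ∀ ℓ : ℕ, ℓ.Prime → (ℓ : ℤ) ∣ c → (ℓ : ℤ) ∣ p * q) :
    IsCoprime ((p : EisensteinInt) + q * sqrtNegThree) (c : EisensteinInt) ∧
      cubicSymbol ((p : EisensteinInt) + q * sqrtNegThree) (c : EisensteinInt) = 1 := by
  have hnat : ∀ c : ℕ, IsCoprime (c : ℤ) 3 →
      (∀ ℓ : ℕ, ℓ.Prime → (ℓ : ℤ) ∣ (c : ℤ) → (ℓ : ℤ) ∣ p * q) →
      IsCoprime ((p : EisensteinInt) + q * sqrtNegThree) (c : EisensteinInt) ∧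
      cubicSymbol ((p : EisensteinInt) + q * sqrtNegThree) (c : EisensteinInt) = 1 := by
    intro c
    induction c using induction_on_primes with
    | zero => intro h; exact absurd h (by decide)
    | one =>
      intro _ _
      rw [Nat.cast_one]
      exact ⟨isCoprime_one_right, cubicSymbol_of_isUnit isUnit_one⟩
    | prime_mul ℓ a hℓ ih =>
      intro h3 hd
      rw [Nat.cast_mul] at h3 hd
      obtain ⟨i1, i2⟩ := ih h3.of_mul_left_right fun r hr hra => hd r hr (hra.mul_left _)
      have hℓ3 := h3.of_mul_left_left
      have hℓ3' := isCoprime_intCast_three.2 hℓ3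
      have ha3' := isCoprime_intCast_three.2 h3.of_mul_left_right
      have hirr : Irreducible (ℓ : ℤ) := (Nat.prime_iff_prime_int.1 hℓ).irreducible
      have hℓd : ∀ z : ℤ, ¬ (ℓ : ℤ) ∣ z → IsCoprime z (ℓ : ℤ) := fun z hz =>
        (hirr.coprime_iff_not_dvd.2 hz).symm
      have hlam : IsCoprime sqrtNegThree ((ℓ : ℤ) : EisensteinInt) :=
        hℓ3'.symm.of_isCoprime_of_dvd_left
          ⟨-sqrtNegThree, by linear_combination sqrtNegThree_sq⟩
      have key : IsCoprime ((p : EisensteinInt) + q * sqrtNegThree) ((ℓ : ℤ) : EisensteinInt) ∧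
          cubicSymbol ((p : EisensteinInt) + q * sqrtNegThree) ((ℓ : ℤ) : EisensteinInt) = 1 := by
        rcases (Nat.prime_iff_prime_int.1 hℓ).dvd_or_dvd (hd ℓ hℓ (dvd_mul_right _ _)) with h | h
        · have hq := hℓd q fun hq => hirr.not_isUnit (hpq.isUnit_of_dvd' h hq)
          obtain ⟨t, ht⟩ := h
          have e : (p : EisensteinInt) + q * sqrtNegThree =
              q * sqrtNegThree + ((ℓ : ℤ) : EisensteinInt) * t := by rw [ht]; push_cast; ring
          rw [e]
          refine ⟨((isCoprime_intCast.2 hq).mul_left hlam).add_mul_left_left _, ?_⟩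
          rw [cubicSymbol_congr hℓ3' (α' := q * sqrtNegThree) ⟨t, by ring⟩,
            cubicSymbol_mul_left hℓ3', cubicSymbol_intCast hℓ3 hq,
            cubicSymbol_sqrtNegThree_intCast hℓ3, one_mul]
        · have hp := hℓd p fun hp => hirr.not_isUnit (hpq.isUnit_of_dvd' hp h)
          obtain ⟨t, ht⟩ := h
          have e : (p : EisensteinInt) + q * sqrtNegThree =
              p + ((ℓ : ℤ) : EisensteinInt) * (t * sqrtNegThree) := by rw [ht]; push_cast; ring
          rw [e]
          refine ⟨(isCoprime_intCast.2 hp).add_mul_left_left _, ?_⟩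
          rw [cubicSymbol_congr hℓ3' (α' := p) ⟨t * sqrtNegThree, by ring⟩,
            cubicSymbol_intCast hℓ3 hp]
      rw [Int.cast_natCast] at key hℓ3'
      rw [Int.cast_natCast] at ha3'
      rw [Nat.cast_mul, cubicSymbol_mul_right (ne_zero_of_isCoprime_three hℓ3')
        (ne_zero_of_isCoprime_three ha3'), key.2, i2, one_mul]
      exact ⟨key.1.mul_right i1, rfl⟩
  obtain ⟨n, rfl | rfl⟩ := c.eq_nat_or_neg
  · simpa using hnat n hc h
  · have hn3 : IsCoprime (n : ℤ) 3 := (IsCoprime.neg_left_iff _ _).1 hc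
    have hn0 := ne_zero_of_isCoprime_three (isCoprime_intCast_three.2 hn3)
    obtain ⟨h1, h2⟩ := hnat n hn3 fun ℓ hℓ hd => h ℓ hℓ (by simpa using hd)
    rw [Int.cast_neg, Int.cast_natCast]
    rw [Int.cast_natCast] at hn0
    refine ⟨h1.neg_right, ?_⟩
    rw [← h2]
    exact (cubicSymbol_associated_right hn0 ⟨-1, by simp⟩).symm

/-- Reciprocity between `p + q √-3` and rational integers: if `ω ^ j (p + q √-3)` is congruent to a
rational integer modulo `3`, then the defect is `(ω/m)₃ ^ j`. -/
theorem exists_cubicSymbol_intCast_eq {p q : ℤ} (hp : IsCoprime p 3) :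
    ∃ j : ℕ, (3 ∣ q → j = 0) ∧ ∀ m : ℤ, IsCoprime m 3 →
      IsCoprime ((p : EisensteinInt) + q * sqrtNegThree) (m : EisensteinInt) →
      cubicSymbol (m : EisensteinInt) ((p : EisensteinInt) + q * sqrtNegThree) =
        cubicSymbol omega (m : EisensteinInt) ^ j *
          cubicSymbol ((p : EisensteinInt) + q * sqrtNegThree) (m : EisensteinInt) := by
  set β := (p : EisensteinInt) + q * sqrtNegThree with hβ
  have hβ3 : IsCoprime β 3 := isCoprime_add_mul_sqrtNegThree_three hp
  obtain ⟨j, hj, hj'⟩ : ∃ j : ℕ, (3 ∣ q → j = 0) ∧ 3 ∣ (omega ^ j * β).im := by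
    by_cases h : 3 ∣ q
    · refine ⟨0, fun _ => rfl, ?_⟩
      have : β.im = 2 * q := by
        simp [hβ, sqrtNegThree, omega, two_mul, QuadraticAlgebra.im_one]
        ring
      rw [pow_zero, one_mul, this]
      exact h.mul_left 2
    · obtain ⟨j, hj⟩ := exists_omega_pow_mul_im hβ3
      exact ⟨j, fun h' => absurd h' h, hj⟩
  refine ⟨j, hj, fun m hm hc => ?_⟩
  have hu := isUnit_omega.pow j
  have hm' := isCoprime_intCast_three.2 hm
  have := cubicSymbol_reciprocity ((isCoprime_of_isUnit_left hu).mul_left hβ3) hj' hm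
    ((isCoprime_of_isUnit_left hu).mul_left hc)
  rw [cubicSymbol_mul_left hm', cubicSymbol_pow hm'] at this
  rw [this]
  exact cubicSymbol_associated_right (ne_zero_of_isCoprime_three hβ3)
    (associated_unit_mul_left β _ hu).symm

end EisensteinInt

/-! ### A congruence modulo `p + q √-3`, and valuations -/

namespace EisensteinInt

/-- How a congruence `3 ^ κ (bh) ^ 2 M ≡ -3 ^ κ' y ^ 2 n ^ 3` modulo `β = p + q √-3` determines
`(β/M)₃`, when the prime factors of `b`, `h` and `y` divide `pq`. The relation for `(3/β)₃` comes
from `q √-3 ≡ -p` modulo `β`. -/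
theorem exists_cubicSymbol_relation {p q b h y M n : ℤ} {κ κ' : ℕ} (hp : IsCoprime p 3)
    (hpq : IsCoprime p q) (hb : IsCoprime b 3) (hh : IsCoprime h 3) (hy : IsCoprime y 3)
    (hd : ∀ ℓ : ℕ, ℓ.Prime → (ℓ : ℤ) ∣ b * h * y → (ℓ : ℤ) ∣ p * q) (hM : IsCoprime M 3)
    (hβM : IsCoprime ((p : EisensteinInt) + q * sqrtNegThree) (M : EisensteinInt))
    (hrel : (p : EisensteinInt) + q * sqrtNegThree ∣
      3 ^ κ * (b * h) ^ 2 * M + 3 ^ κ' * y ^ 2 * n ^ 3) :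
    ∃ j : ℕ, (3 ∣ q → j = 0) ∧
      cubicSymbol 3 ((p : EisensteinInt) + q * sqrtNegThree) ^ 3 = 1 ∧
      (IsCoprime q 3 → cubicSymbol 3 ((p : EisensteinInt) + q * sqrtNegThree) =
        (cubicSymbol omega (p : EisensteinInt) ^ j) ^ 2 *
          cubicSymbol omega (q : EisensteinInt) ^ j) ∧
      cubicSymbol 3 ((p : EisensteinInt) + q * sqrtNegThree) ^ κ *
          (cubicSymbol omega (b : EisensteinInt) ^ j *
            cubicSymbol omega (h : EisensteinInt) ^ j) ^ 2 *
          (cubicSymbol omega (M : EisensteinInt) ^ j *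
            cubicSymbol ((p : EisensteinInt) + q * sqrtNegThree) (M : EisensteinInt)) =
        cubicSymbol 3 ((p : EisensteinInt) + q * sqrtNegThree) ^ κ' *
          (cubicSymbol omega (y : EisensteinInt) ^ j) ^ 2 := by
  obtain ⟨j, hj, hrec⟩ := exists_cubicSymbol_intCast_eq (q := q) hp
  have hβ3 : IsCoprime ((p : EisensteinInt) + q * sqrtNegThree) 3 :=
    isCoprime_add_mul_sqrtNegThree_three hp
  have hgood : ∀ c : ℤ, IsCoprime c 3 → (∀ ℓ : ℕ, ℓ.Prime → (ℓ : ℤ) ∣ c → (ℓ : ℤ) ∣ p * q) →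
      IsCoprime ((p : EisensteinInt) + q * sqrtNegThree) (c : EisensteinInt) ∧
      cubicSymbol (c : EisensteinInt) ((p : EisensteinInt) + q * sqrtNegThree) =
        cubicSymbol omega (c : EisensteinInt) ^ j := by
    intro c hc hcd
    obtain ⟨h1, h2⟩ := cubicSymbol_add_mul_sqrtNegThree_eq_one hpq hc hcd
    exact ⟨h1, by rw [hrec c hc h1, h2, mul_one]⟩
  obtain ⟨b1, b2⟩ := hgood b hb fun ℓ hℓ h' => hd ℓ hℓ ((h'.mul_right _).mul_right _)
  obtain ⟨h1, h2⟩ := hgood h hh fun ℓ hℓ h' => hd ℓ hℓ ((h'.mul_left _).mul_right _)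
  obtain ⟨y1, y2⟩ := hgood y hy fun ℓ hℓ h' => hd ℓ hℓ (h'.mul_left _)
  have hM2 := hrec M hM hβM
  set β := (p : EisensteinInt) + q * sqrtNegThree with hβ
  refine ⟨j, hj, cubicSymbol_pow_three hβ3 hβ3.symm, fun hq => ?_, ?_⟩
  · obtain ⟨p1, p2⟩ := hgood p hp fun ℓ hℓ h' => h'.mul_right _
    obtain ⟨q1, q2⟩ := hgood q hq fun ℓ hℓ h' => h'.mul_left _
    have hs : cubicSymbol (q : EisensteinInt) β * cubicSymbol sqrtNegThree β =
        cubicSymbol (p : EisensteinInt) β := by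
      rw [← cubicSymbol_mul_left hβ3, ← cubicSymbol_neg (α := p) hβ3]
      exact cubicSymbol_congr hβ3 ⟨1, by rw [hβ]; ring⟩
    have h3 : cubicSymbol 3 β = cubicSymbol sqrtNegThree β ^ 2 := by
      rw [← cubicSymbol_pow hβ3, sqrtNegThree_sq, cubicSymbol_neg hβ3]
    have hq3 := cubicSymbol_pow_three hβ3 q1.symm
    rw [← p2, ← q2, h3, ← hs]
    linear_combination (-cubicSymbol sqrtNegThree β ^ 2) * hq3
  · have hn : IsCoprime (n : EisensteinInt) β := by
      have h3 : IsCoprime β (3 ^ κ * (b * h) ^ 2 * M) :=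
        ((hβ3.pow_right).mul_right ((b1.mul_right h1).pow_right)).mul_right hβM
      obtain ⟨t, ht⟩ := hrel
      have h4 : IsCoprime β (3 ^ κ' * y ^ 2 * n ^ 3) := by
        have e : (3 ^ κ' * y ^ 2 * n ^ 3 : EisensteinInt) =
          -(3 ^ κ * (b * h) ^ 2 * M) + β * t := by rw [← ht]; ring
        rw [e]
        exact h3.neg_right.add_mul_left_right t
      exact ((IsCoprime.pow_right_iff (by norm_num)).1 h4.of_mul_right_right).symm
    have key : cubicSymbol (3 ^ κ * (b * h) ^ 2 * M) β =
        cubicSymbol (3 ^ κ' * y ^ 2 * n ^ 3) β := by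
      rw [← cubicSymbol_neg (α := 3 ^ κ' * y ^ 2 * n ^ 3) hβ3]
      exact cubicSymbol_congr hβ3 (by rwa [sub_neg_eq_add])
    simp only [cubicSymbol_mul_left hβ3, cubicSymbol_pow hβ3, cubicSymbol_pow_three hβ3 hn] at key
    rw [b2, h2, y2, hM2, mul_one] at key
    exact key

end EisensteinInt

section Arithmetic

theorem exists_isCoprime_factor (a b : ℤ) (ha : a ≠ 0) :
    ∃ g a' b' : ℤ, a = g * a' ∧ b = g * b' ∧ IsCoprime a' b' := by
  obtain ⟨a', b', h, h1, h2⟩ := Int.exists_gcd_one (Int.gcd_pos_of_ne_zero_left b ha)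
  exact ⟨_, a', b', h1.trans (mul_comm _ _), h2.trans (mul_comm _ _),
    Int.isCoprime_iff_gcd_eq_one.2 h⟩

theorem exists_eq_pow_mul {ℓ : ℤ} (hℓ : Prime ℓ) {a : ℤ} (ha : a ≠ 0) :
    ∃ (k : ℕ) (c : ℤ), a = ℓ ^ k * c ∧ ¬ ℓ ∣ c := by
  obtain ⟨c, hc, hc'⟩ :=
    (FiniteMultiplicity.of_prime_left hℓ ha).exists_eq_pow_mul_and_not_dvd
  exact ⟨_, c, hc, hc'⟩

/-- If the valuation at `ℓ` of a cube is `2 τ`, then `3 ∣ τ`. -/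
theorem three_dvd_of_pow_three_eq {ℓ : ℤ} (hℓ : Prime ℓ) {n c : ℤ} {τ : ℕ}
    (h : n ^ 3 = ℓ ^ (2 * τ) * c) (hc : ¬ ℓ ∣ c) : 3 ∣ τ := by
  have hn : n ≠ 0 := by
    rintro rfl
    have : ℓ ^ (2 * τ) * c = 0 := by rw [← h]; norm_num
    rcases mul_eq_zero.1 this with h | h
    · exact pow_ne_zero _ hℓ.ne_zero h
    · exact hc (h ▸ dvd_zero _)
  obtain ⟨ν, m, rfl, hm⟩ := exists_eq_pow_mul hℓ hn
  have hm3 : ¬ ℓ ∣ m ^ 3 := fun h => hm (hℓ.dvd_of_dvd_pow h)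
  rw [mul_pow, ← pow_mul] at h
  have e1 : emultiplicity ℓ (ℓ ^ (ν * 3) * m ^ 3) = (ν * 3 : ℕ) := by
    rw [emultiplicity_mul hℓ, emultiplicity_pow_self_of_prime hℓ,
      emultiplicity_eq_zero.2 hm3, add_zero]
  have e2 : emultiplicity ℓ (ℓ ^ (2 * τ) * c) = (2 * τ : ℕ) := by
    rw [emultiplicity_mul hℓ, emultiplicity_pow_self_of_prime hℓ,
      emultiplicity_eq_zero.2 hc, add_zero]
  rw [h, e2] at e1
  have : 2 * τ = ν * 3 := by exact_mod_cast e1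
  omega

variable {D n A B : ℤ}

/-- If `v(A ^ 2) < v(D B ^ 2)` and `v(A) ≤ v(B)` at a prime `ℓ`, then `ℓ ∤ A`, since
`A ^ 2 - D B ^ 2` is a cube and `ℓ ^ 3` is not a common divisor. -/
theorem valuation_left_eq_zero (hN : A ^ 2 - D * B ^ 2 = n ^ 3)
    (hcf : ∀ ℓ : ℕ, ℓ.Prime → ¬ ((ℓ : ℤ) ^ 3 ∣ A ∧ (ℓ : ℤ) ^ 3 ∣ B)) {ℓ : ℕ} (hℓ : ℓ.Prime)
    {τ : ℕ} {A' : ℤ} (hA : A = ℓ ^ τ * A') (hA' : ¬ (ℓ : ℤ) ∣ A') (hB : (ℓ : ℤ) ^ τ ∣ B)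
    (hDB : (ℓ : ℤ) ^ (2 * τ + 1) ∣ D * B ^ 2) : τ = 0 := by
  have hℓ' := Nat.prime_iff_prime_int.1 hℓ
  obtain ⟨e, he⟩ := hDB
  have h3 : 3 ∣ τ := by
    refine three_dvd_of_pow_three_eq hℓ' (n := n) (c := A' ^ 2 - ℓ * e) ?_ ?_
    · rw [← hN, he, hA]; ring
    · intro h
      refine hA' (hℓ'.dvd_of_dvd_pow (n := 2) ?_)
      simpa using dvd_add h (dvd_mul_right (ℓ : ℤ) e)
  by_contra h0
  have : 3 ≤ τ := Nat.le_of_dvd (Nat.pos_of_ne_zero h0) h3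
  exact hcf ℓ hℓ ⟨hA ▸ (pow_dvd_pow _ this).mul_right _, (pow_dvd_pow _ this).trans hB⟩

/-- If `v(B) < v(A)` and `ℓ ∤ D` at a prime `ℓ`, then `ℓ ∤ B`, since `A ^ 2 - D B ^ 2` is a cube and
`ℓ ^ 3` is not a common divisor. -/
theorem valuation_right_eq_zero (hN : A ^ 2 - D * B ^ 2 = n ^ 3)
    (hcf : ∀ ℓ : ℕ, ℓ.Prime → ¬ ((ℓ : ℤ) ^ 3 ∣ A ∧ (ℓ : ℤ) ^ 3 ∣ B)) {ℓ : ℕ} (hℓ : ℓ.Prime)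
    {τ : ℕ} {B' : ℤ} (hB : B = ℓ ^ τ * B') (hB' : ¬ (ℓ : ℤ) ∣ D * B')
    (hA : (ℓ : ℤ) ^ (τ + 1) ∣ A) : τ = 0 := by
  have hℓ' := Nat.prime_iff_prime_int.1 hℓ
  obtain ⟨e, he⟩ := hA
  have h3 : 3 ∣ τ := by
    refine three_dvd_of_pow_three_eq hℓ' (n := n) (c := ℓ * (ℓ * e ^ 2) - D * B' ^ 2) ?_ ?_
    · rw [← hN, he, hB]; ring
    · intro h
      have h1 : (ℓ : ℤ) ∣ D * B' ^ 2 := by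
        have := dvd_sub (dvd_mul_right (ℓ : ℤ) (ℓ * e ^ 2)) h
        rwa [sub_sub_cancel] at this
      refine hB' ?_
      rcases hℓ'.dvd_or_dvd h1 with h | h
      · exact h.mul_right _
      · exact (hℓ'.dvd_of_dvd_pow h).mul_left _
  by_contra h0
  have : 3 ≤ τ := Nat.le_of_dvd (Nat.pos_of_ne_zero h0) h3
  exact hcf ℓ hℓ ⟨he ▸ (pow_dvd_pow _ (by omega)).mul_right _,
    hB ▸ (pow_dvd_pow _ this).mul_right _⟩

end Arithmetic

/-! ### The symbol of `B X + A Y √-3` -/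

namespace EisensteinInt

/-- A square prime to `3` that is a cube modulo `9` is `1` modulo `9`. -/
theorem sq_mod_nine_of_sq_sub_eq_cube {A B D n : ℤ} (hN : A ^ 2 - D * B ^ 2 = n ^ 3)
    (hA : ¬ 3 ∣ A) (hB : 3 ∣ B) : 9 ∣ A ^ 2 - 1 := by
  obtain ⟨t, rfl⟩ := hB
  have h1 : A ^ 2 = n ^ 3 + 9 * (D * t ^ 2) := by linear_combination hN
  have h2 : n ^ 3 % 9 = 0 ∨ n ^ 3 % 9 = 1 ∨ n ^ 3 % 9 = 8 := by
    have : n % 9 = 0 ∨ n % 9 = 1 ∨ n % 9 = 2 ∨ n % 9 = 3 ∨ n % 9 = 4 ∨ n % 9 = 5 ∨ n % 9 = 6 ∨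
      n % 9 = 7 ∨ n % 9 = 8 := by omega
    rcases this with h | h | h | h | h | h | h | h | h <;> simp [pow_succ, Int.mul_emod, h]
  have h3 : A ^ 2 % 9 = 1 ∨ A ^ 2 % 9 = 4 ∨ A ^ 2 % 9 = 7 := by
    have : A % 9 = 1 ∨ A % 9 = 2 ∨ A % 9 = 4 ∨ A % 9 = 5 ∨ A % 9 = 7 ∨ A % 9 = 8 := by omega
    rcases this with h | h | h | h | h | h <;> simp [pow_succ, Int.mul_emod, h]
  omega

/-- Elimination among cube roots of unity, for the case in which `3` divides the rational part of
`r + s √-3` exactly once. The variables stand for powers of the symbols of `ω`, and `z` for the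
symbol to be computed. -/
theorem eq_one_of_relation_left {R : Type*} [CommRing R] {a b h k x y z : R} (hb : b ^ 3 = 1)
    (hx : x ^ 3 = 1) (hy : y ^ 3 = 1) (hhka : h * k * a = 1)
    (hz : (a * y) ^ 2 * (b * x) * (b * h) ^ 2 * ((k * x) ^ 2 * z) = y ^ 2) : z = 1 := by
  have e : z * b ^ 3 * x ^ 3 * y ^ 3 * (h * k * a) ^ 2 = y ^ 3 := by linear_combination y * hz
  simpa [hb, hx, hy, hhka] using e

/-- Elimination among cube roots of unity, for the case in which `3` divides neither coordinate of
`r + s √-3`. The variables are those of `eq_one_of_relation_left`. -/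
theorem eq_one_of_relation_right {R : Type*} [CommRing R] {a b h k x y z : R} (hb : b ^ 3 = 1)
    (hx : x ^ 3 = 1) (hy : y ^ 3 = 1) (ha : a ^ 3 = 1) (hhka : h * k * a = 1)
    (hz : (b * h) ^ 2 * ((k * x) ^ 2 * z) = (b * x) ^ 2 * (a * y) * y ^ 2) : z = 1 := by
  have e : z * b ^ 3 * x ^ 3 * (h * k * a) ^ 2 = b ^ 3 * x ^ 3 * a ^ 3 * y ^ 3 := by
    linear_combination b * x * a ^ 2 * hz
  simpa [hb, hx, hy, ha, hhka] using e

/-- Let `h` be a common factor of `A` and `B`. In the given factorizations, a prime factor of `h`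
divides one of `B₂`, `X₁`, `A₃`, `Y₁`. Otherwise the valuations of `A ^ 2` and `D B ^ 2` at it
differ, which cubefreeness excludes; or it is odd and prime to `D` and `Y`, against `hodd`; or it is
`2`, and divides both `M` and `n`. -/
theorem prime_dvd_mul_of_dvd_common_factor {D n A B X Y M g h k A₃ B₂ X₁ Y₁ : ℤ}
    (hN : A ^ 2 - D * B ^ 2 = n ^ 3)
    (hcf : ∀ ℓ : ℕ, ℓ.Prime → ¬ ((ℓ : ℤ) ^ 3 ∣ A ∧ (ℓ : ℤ) ^ 3 ∣ B))
    (hMdef : M = X ^ 2 + 3 * D * Y ^ 2) (hMn : IsCoprime M n) (hXD : IsCoprime X D)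
    (hXY : IsCoprime X Y)
    (hodd : ∀ ℓ : ℕ, ℓ.Prime → ℓ ≠ 2 → (ℓ : ℤ) ∣ A → (ℓ : ℤ) ∣ B → ¬ (ℓ : ℤ) ∣ D → (ℓ : ℤ) ∣ Y)
    (hh0 : h ≠ 0) (hA : A = h * k * A₃) (hB' : B = g * h * B₂) (hX : X = k * X₁) (hY : Y = g * Y₁)
    {ℓ : ℕ} (hℓ : ℓ.Prime) (hℓh : (ℓ : ℤ) ∣ h) : (ℓ : ℤ) ∣ (B₂ * X₁) * (A₃ * Y₁) := by
  have hℓ' := Nat.prime_iff_prime_int.1 hℓ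
  by_contra hnd
  have hnB₂ : ¬ (ℓ : ℤ) ∣ B₂ := fun h' => hnd ((h'.mul_right _).mul_right _)
  have hnX₁ : ¬ (ℓ : ℤ) ∣ X₁ := fun h' => hnd ((h'.mul_left _).mul_right _)
  have hnA₃ : ¬ (ℓ : ℤ) ∣ A₃ := fun h' => hnd ((h'.mul_right _).mul_left _)
  have hnY₁ : ¬ (ℓ : ℤ) ∣ Y₁ := fun h' => hnd ((h'.mul_left _).mul_left _)
  have hℓA : (ℓ : ℤ) ∣ A := by rw [hA]; exact (hℓh.mul_right _).mul_right _
  have hℓB : (ℓ : ℤ) ∣ B := by rw [hB']; exact (hℓh.mul_left _).mul_right _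
  obtain ⟨τ, h', hh', hh'n⟩ := exists_eq_pow_mul hℓ' hh0
  have hτ : τ ≠ 0 := by
    rintro rfl
    exact hh'n (by simpa [hh'] using hℓh)
  by_cases hk : (ℓ : ℤ) ∣ k
  · have hnXY : ∀ z, IsCoprime X z → ¬ (ℓ : ℤ) ∣ z := fun z hz hd =>
      hℓ'.not_isUnit (hz.isUnit_of_dvd' (hX ▸ hk.mul_right _) hd)
    have hnD := hnXY D hXD
    have hng : ¬ (ℓ : ℤ) ∣ g := fun hd => hnXY Y hXY (hY ▸ hd.mul_right _)
    refine hτ (valuation_right_eq_zero hN hcf hℓ (τ := τ) (B' := g * h' * B₂)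
      (by rw [hB', hh']; ring) ?_ ?_)
    · exact hℓ'.not_dvd_mul hnD (hℓ'.not_dvd_mul (hℓ'.not_dvd_mul hng hh'n) hnB₂)
    · obtain ⟨c, hc⟩ := hk
      exact ⟨h' * c * A₃, by rw [hA, hh', hc]; ring⟩
  · by_cases hDg : (ℓ : ℤ) ∣ D * g
    · refine hτ (valuation_left_eq_zero hN hcf hℓ (τ := τ) (A' := h' * k * A₃)
        (by rw [hA, hh']; ring) (hℓ'.not_dvd_mul (hℓ'.not_dvd_mul hh'n hk) hnA₃)
        ⟨g * h' * B₂, by rw [hB', hh']; ring⟩ ?_)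
      obtain ⟨c, hc⟩ := hDg
      exact ⟨c * g * (h' * B₂) ^ 2, by
        rw [hB', hh']; linear_combination (ℓ : ℤ) ^ (2 * τ) * g * (h' * B₂) ^ 2 * hc⟩
    · have hnD : ¬ (ℓ : ℤ) ∣ D := fun h' => hDg (h'.mul_right _)
      have hnY : ¬ (ℓ : ℤ) ∣ Y := by
        rw [hY]
        exact hℓ'.not_dvd_mul (fun h' => hDg (h'.mul_left _)) hnY₁
      have hnX : ¬ (ℓ : ℤ) ∣ X := by rw [hX]; exact hℓ'.not_dvd_mul hk hnX₁
      by_cases h2 : ℓ = 2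
      · subst h2
        have hn : (2 : ℤ) ∣ n := by
          refine hℓ'.dvd_of_dvd_pow (n := 3) ?_
          rw [← hN]
          exact dvd_sub (dvd_pow hℓA two_ne_zero) ((dvd_pow hℓB two_ne_zero).mul_left _)
        have hM2 : (2 : ℤ) ∣ M := by
          have hX2 : X % 2 = 1 := by
            have := hnX; push_cast at this; omega
          have hY2 : Y % 2 = 1 := by
            have := hnY; push_cast at this; omega
          have hD2 : D % 2 = 1 := by
            have := hnD; push_cast at this; omega
          rw [hMdef]
          refine Int.dvd_of_emod_eq_zero ?_
          simp [pow_two, Int.add_emod, Int.mul_emod, hX2, hY2, hD2]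
        exact hℓ'.not_isUnit (hMn.isUnit_of_dvd' (by exact_mod_cast hM2) (by exact_mod_cast hn))
      · exact hnY (hodd ℓ hℓ h2 hℓA hℓB hnD)

/-- Let `M = X ^ 2 + 3 D Y ^ 2` be prime to `3 n D Y`, where `A ^ 2 - D B ^ 2 = n ^ 3`. Under the
local conditions on the common prime factors of `A` and `B`, the symbol of `B X + A Y √-3` over `M`
is trivial. -/
theorem cubicSymbol_eq_one_of_norm_eq_cube {D n A B X Y M : ℤ} (hN : A ^ 2 - D * B ^ 2 = n ^ 3)
    (hcf : ∀ ℓ : ℕ, ℓ.Prime → ¬ ((ℓ : ℤ) ^ 3 ∣ A ∧ (ℓ : ℤ) ^ 3 ∣ B))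
    (hMdef : M = X ^ 2 + 3 * D * Y ^ 2) (hM : IsCoprime M (3 * n * D * Y)) (hY3 : 3 ∣ Y)
    (hodd : ∀ ℓ : ℕ, ℓ.Prime → ℓ ≠ 2 → (ℓ : ℤ) ∣ A → (ℓ : ℤ) ∣ B → ¬ (ℓ : ℤ) ∣ D → (ℓ : ℤ) ∣ Y)
    (h9 : 3 ∣ A → 3 ∣ B → ¬ 3 ∣ D → 9 ∣ Y) (hB0 : B ≠ 0) (hY0 : Y ≠ 0) :
    cubicSymbol (B * X + A * Y * sqrtNegThree) (M : EisensteinInt) = 1 := by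
  have hM3 : IsCoprime M 3 := hM.of_mul_right_left.of_mul_right_left.of_mul_right_left
  have hMn : IsCoprime M n := hM.of_mul_right_left.of_mul_right_left.of_mul_right_right
  have hMD : IsCoprime M D := hM.of_mul_right_left.of_mul_right_right
  have hMY : IsCoprime M Y := hM.of_mul_right_right
  have hXc : ∀ z : ℤ, z ∣ 3 * D * Y ^ 2 → IsCoprime M z → IsCoprime X z := by
    rintro z ⟨w, hw⟩ hz
    rw [hMdef, hw] at hz
    exact (IsCoprime.pow_left_iff (by norm_num)).1 (IsCoprime.of_add_mul_left_left hz)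
  have hX3 : IsCoprime X 3 := hXc 3 ⟨D * Y ^ 2, by ring⟩ hM3
  have hXD : IsCoprime X D := hXc D ⟨3 * Y ^ 2, by ring⟩ hMD
  have hXY : IsCoprime X Y := hXc Y ⟨3 * D * Y, by ring⟩ hMY
  have hXM : IsCoprime X M := by
    have h1 : IsCoprime X (3 * D * Y ^ 2) := (hX3.mul_right hXD).mul_right hXY.pow_right
    rw [hMdef, pow_two, add_comm]
    exact h1.add_mul_left_right X
  have hX0 : X ≠ 0 := by
    rintro rfl
    revert hX3; decide
  -- remove the common factors of `B X` and `A Y`; the coprime coordinates `r = B₂ X₁` and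
  -- `s = A₃ Y₁` remain
  obtain ⟨g, B₁, Y₁, hB, hY, hBY⟩ := exists_isCoprime_factor B Y hB0
  have hB₁0 : B₁ ≠ 0 := right_ne_zero_of_mul (hB ▸ hB0)
  have hg0 : g ≠ 0 := left_ne_zero_of_mul (hB ▸ hB0)
  obtain ⟨h, B₂, A₂, hB₁, hA₂, hBA⟩ := exists_isCoprime_factor B₁ A hB₁0
  have hh0 : h ≠ 0 := left_ne_zero_of_mul (hB₁ ▸ hB₁0)
  have hB₂0 : B₂ ≠ 0 := right_ne_zero_of_mul (hB₁ ▸ hB₁0)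
  obtain ⟨k, X₁, A₃, hX, hA₃, hXA⟩ := exists_isCoprime_factor X A₂ hX0
  have hY₁0 : Y₁ ≠ 0 := right_ne_zero_of_mul (hY ▸ hY0)
  have hA : A = h * k * A₃ := by rw [hA₂, hA₃]; ring
  have hB' : B = g * h * B₂ := by rw [hB, hB₁]; ring
  have hX₁3 : IsCoprime X₁ 3 := (hX ▸ hX3).of_mul_left_right
  have hk3 : IsCoprime k 3 := (hX ▸ hX3).of_mul_left_left
  have hrs : IsCoprime (B₂ * X₁) (A₃ * Y₁) :=
    ((hA₃ ▸ hBA).of_mul_right_right.mul_right (hB₁ ▸ hBY).of_mul_left_right).mul_left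
      (hXA.mul_right (hX ▸ hY ▸ hXY).of_mul_left_right.of_mul_right_right)
  have hgM : IsCoprime g M := (hY ▸ hMY).of_mul_right_left.symm
  have hkM : IsCoprime k M := (hX ▸ hXM).of_mul_left_left
  have hhM : IsCoprime h M := by
    have h1 : h ∣ n ^ 3 := ⟨h * (k * A₃) ^ 2 - D * h * (g * B₂) ^ 2, by rw [← hN, hA, hB']; ring⟩
    exact (hMn.pow_right (n := 3)).symm.of_isCoprime_of_dvd_left h1
  have hrel : (h * B₂) ^ 2 * M + 3 * Y₁ ^ 2 * n ^ 3 =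
      (h * k) ^ 2 * ((B₂ * X₁) ^ 2 + 3 * (A₃ * Y₁) ^ 2) := by
    refine mul_left_cancel₀ (pow_ne_zero 2 hg0) ?_
    rw [← hN, hMdef, hA, hB', hX, hY]; ring
  have hNM : IsCoprime ((B₂ * X₁) ^ 2 + 3 * (A₃ * Y₁) ^ 2) M := by
    have h1 : IsCoprime (3 * Y₁ ^ 2 * n ^ 3) M :=
      ((hM3.symm.mul_left ((hY ▸ hMY).of_mul_right_right.symm.pow_left)).mul_left
        hMn.symm.pow_left)
    have h2 := h1.add_mul_left_left ((h * B₂) ^ 2)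
    rw [mul_comm M, add_comm, hrel] at h2
    exact h2.of_mul_left_right
  have hdvd : ∀ p q : ℤ, (p : EisensteinInt) + q * sqrtNegThree ∣
      ((p ^ 2 + 3 * q ^ 2 : ℤ) : EisensteinInt) := fun p q =>
    ⟨p - q * sqrtNegThree, by
      push_cast; linear_combination (q : EisensteinInt) ^ 2 * sqrtNegThree_sq⟩
  have hM3' := isCoprime_intCast_three.2 hM3
  have hβM : IsCoprime (((B₂ * X₁ : ℤ) : EisensteinInt) + (A₃ * Y₁ : ℤ) * sqrtNegThree)
      (M : EisensteinInt) :=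
    (isCoprime_intCast.2 hNM).of_isCoprime_of_dvd_left (hdvd _ _)
  have hred : cubicSymbol (B * X + A * Y * sqrtNegThree) (M : EisensteinInt) =
      cubicSymbol (((B₂ * X₁ : ℤ) : EisensteinInt) + (A₃ * Y₁ : ℤ) * sqrtNegThree)
        (M : EisensteinInt) := by
    have e : (B * X + A * Y * sqrtNegThree : EisensteinInt) = ((g * h * k : ℤ) : EisensteinInt) *
        (((B₂ * X₁ : ℤ) : EisensteinInt) + (A₃ * Y₁ : ℤ) * sqrtNegThree) := by
      rw [hA, hB', hX, hY]; push_cast; ring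
    rw [e, cubicSymbol_mul_left hM3', cubicSymbol_intCast hM3 ((hgM.mul_left hhM).mul_left hkM),
      one_mul]
  rw [hred]
  clear hred
  have hprime : ∀ ℓ : ℕ, ℓ.Prime → (ℓ : ℤ) ∣ h → (ℓ : ℤ) ∣ (B₂ * X₁) * (A₃ * Y₁) := fun ℓ hℓ hℓh =>
    prime_dvd_mul_of_dvd_common_factor hN hcf hMdef hMn hXD hXY hodd hh0 hA hB' hX hY hℓ hℓh
  have hp3 : Prime (3 : ℤ) := Int.prime_three
  obtain ⟨i, h', hh', hh'n⟩ := exists_eq_pow_mul hp3 hh0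
  have hk3n := isCoprime_three_int_iff.1 hk3
  have hX₁3n := isCoprime_three_int_iff.1 hX₁3
  -- the factor `3` of `Y` makes `v₃(B) > v₃(A)`
  have hh3 : ¬ 3 ∣ Y₁ → ¬ 3 ∣ A₃ → i = 0 := by
    intro hY₁ hA₃
    obtain ⟨c, hc⟩ := (hp3.dvd_or_dvd (hY ▸ hY3)).resolve_right hY₁
    refine valuation_left_eq_zero hN hcf Nat.prime_three (τ := i) (A' := h' * k * A₃) ?_ ?_ ?_ ?_
    · rw [hA, hh']; push_cast; ring
    · exact hp3.not_dvd_mul (hp3.not_dvd_mul hh'n hk3n) hA₃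
    · exact ⟨g * h' * B₂, by rw [hB', hh']; push_cast; ring⟩
    · exact ⟨D * 3 * (c * h' * B₂) ^ 2, by rw [hB', hh', hc]; push_cast; ring⟩
  have hE3 : ∀ (c : ℤ) (j : ℕ), IsCoprime c 3 →
      (cubicSymbol omega (c : EisensteinInt) ^ j) ^ 3 = 1 := fun c j hc => by
    rw [← pow_mul, mul_comm, pow_mul, cubicSymbol_omega_pow_three hc, one_pow]
  have hEmul : ∀ (c d : ℤ) (j : ℕ), IsCoprime c 3 → IsCoprime d 3 →
      cubicSymbol omega ((c * d : ℤ) : EisensteinInt) ^ j =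
        cubicSymbol omega (c : EisensteinInt) ^ j * cubicSymbol omega (d : EisensteinInt) ^ j :=
    fun c d j hc hd => by rw [cubicSymbol_omega_mul hc hd, mul_pow]
  have hEM : ∀ j : ℕ, cubicSymbol omega (M : EisensteinInt) ^ j =
      (cubicSymbol omega (k : EisensteinInt) ^ j *
        cubicSymbol omega (X₁ : EisensteinInt) ^ j) ^ 2 := by
    intro j
    rw [cubicSymbol_omega_intCast_congr hM3 (hX3.mul_left hX3), hEmul _ _ _ hX3 hX3, hX,
      hEmul _ _ _ hk3 hX₁3, pow_two]
    obtain ⟨c, hc⟩ := hY3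
    exact ⟨6 * D * c ^ 2 * X ^ 2 + 81 * D ^ 2 * c ^ 4, by rw [hMdef, hc]; ring⟩
  have hEA : ∀ j : ℕ, ¬ 3 ∣ Y₁ → ¬ 3 ∣ A₃ → ¬ 3 ∣ h →
      cubicSymbol omega (h : EisensteinInt) ^ j * cubicSymbol omega (k : EisensteinInt) ^ j *
        cubicSymbol omega (A₃ : EisensteinInt) ^ j = 1 := by
    intro j hY₁ hA₃ hh
    have hB3 : 3 ∣ B := by
      rw [hB]; exact ((hp3.dvd_or_dvd (hY ▸ hY3)).resolve_right hY₁).mul_right _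
    have hA3 : ¬ 3 ∣ A := by
      rw [hA]; exact hp3.not_dvd_mul (hp3.not_dvd_mul hh hk3n) hA₃
    have h1 := sq_mod_nine_of_sq_sub_eq_cube hN hA3 hB3
    have hh' := isCoprime_three_int_iff.2 hh
    have hA₃' := isCoprime_three_int_iff.2 hA₃
    rw [← hEmul _ _ _ hh' hk3, ← hEmul _ _ _ (hh'.mul_left hk3) hA₃', ← hA,
      cubicSymbol_omega_intCast_congr (isCoprime_three_int_iff.2 hA3) isCoprime_one_left
        (by simpa using h1), Int.cast_one, cubicSymbol_of_isUnit isUnit_one, one_pow]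
  by_cases hr3 : 3 ∣ B₂ * X₁
  · -- `3 ∣ r`: divide `r + s √-3` by `√-3`
    obtain ⟨B₃, hB₃⟩ := (hp3.dvd_or_dvd hr3).resolve_right hX₁3n
    have hs3 : ¬ 3 ∣ A₃ * Y₁ := fun h' => hp3.not_isUnit (hrs.isUnit_of_dvd' hr3 h')
    have hs3' := isCoprime_three_int_iff.2 hs3
    have hA₃n : ¬ 3 ∣ A₃ := fun h' => hs3 (h'.mul_right _)
    have hY₁n : ¬ 3 ∣ Y₁ := fun h' => hs3 (h'.mul_left _)
    have hi0 := hh3 hY₁n hA₃n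
    rw [hi0, pow_zero, one_mul] at hh'
    rw [← hh'] at hh'n
    have hB₃0 : B₃ ≠ 0 := right_ne_zero_of_mul (hB₃ ▸ hB₂0)
    obtain ⟨t, b, hb, hbn⟩ := exists_eq_pow_mul hp3 hB₃0
    have e0 : ((B₂ * X₁ : ℤ) : EisensteinInt) + (A₃ * Y₁ : ℤ) * sqrtNegThree =
        sqrtNegThree * (((A₃ * Y₁ : ℤ) : EisensteinInt) + (-(B₃ * X₁) : ℤ) * sqrtNegThree) := by
      rw [hB₃]; push_cast
      linear_combination (B₃ * X₁ : EisensteinInt) * sqrtNegThree_sq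
    rw [e0] at hβM ⊢
    rw [cubicSymbol_mul_left hM3', cubicSymbol_sqrtNegThree_intCast hM3, one_mul]
    have hpq : IsCoprime (A₃ * Y₁) (-(B₃ * X₁)) := by
      rw [hB₃, mul_assoc] at hrs
      exact hrs.of_mul_left_right.symm.neg_right
    have hrel' : 3 * (h * B₃) ^ 2 * M + Y₁ ^ 2 * n ^ 3 =
        (h * k) ^ 2 * ((A₃ * Y₁) ^ 2 + 3 * (-(B₃ * X₁)) ^ 2) := by
      refine mul_left_cancel₀ (by norm_num : (3 : ℤ) ≠ 0) ?_
      rw [hB₃] at hrel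
      linear_combination hrel
    obtain ⟨j, hj, hT3, hT, hR⟩ := exists_cubicSymbol_relation (b := b) (h := h) (y := Y₁) (n := n)
      (κ := 1 + 2 * t) (κ' := 0) hs3' hpq (isCoprime_three_int_iff.2 hbn)
      (isCoprime_three_int_iff.2 hh'n) (isCoprime_three_int_iff.2 hY₁n) (by
        intro ℓ hℓ hd
        have hℓ' := Nat.prime_iff_prime_int.1 hℓ
        rw [mul_neg, dvd_neg]
        rcases hℓ'.dvd_or_dvd hd with hd | hd
        · rcases hℓ'.dvd_or_dvd hd with hd | hd
          · exact ((hb ▸ hd.mul_left _ : (ℓ : ℤ) ∣ B₃).mul_right _).mul_left _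
          · by_cases hℓ3 : ℓ = 3
            · subst hℓ3
              exact absurd (by exact_mod_cast hd) hh'n
            · have h1 := hprime ℓ hℓ hd
              rw [hB₃, show 3 * B₃ * X₁ * (A₃ * Y₁) = 3 * (A₃ * Y₁ * (B₃ * X₁)) by ring] at h1
              refine (hℓ'.dvd_or_dvd h1).resolve_left fun h3 => hℓ3 ?_
              exact (Nat.prime_dvd_prime_iff_eq hℓ Nat.prime_three).1 (by exact_mod_cast h3)
        · exact (hd.mul_left _).mul_right _) hM3 hβM.of_mul_left_right (by
        refine ((hdvd _ _).mul_left (((h * k) ^ 2 : ℤ) : EisensteinInt)).trans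
          (dvd_of_eq ?_)
        rw [← Int.cast_mul, ← hrel', hb]; push_cast; ring)
    have hr' : ¬ 3 ∣ b * X₁ := hp3.not_dvd_mul hbn hX₁3n
    by_cases ht : t = 0
    · rw [ht, pow_zero, one_mul] at hb
      rw [← hb] at hbn hr' hR
      have hB₃3 := isCoprime_three_int_iff.2 hbn
      have hT' := hT (isCoprime_three_int_iff.2 (by rwa [dvd_neg]))
      rw [cubicSymbol_omega_intCast_congr (c := -(B₃ * X₁)) (d := B₃ * X₁)
        (isCoprime_three_int_iff.2 (by rwa [dvd_neg])) (isCoprime_three_int_iff.2 hr')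
        ⟨0, by ring⟩, hEmul _ _ _ hB₃3 hX₁3,
        hEmul _ _ _ (isCoprime_three_int_iff.2 hA₃n) (isCoprime_three_int_iff.2 hY₁n)] at hT'
      have c1 := hE3 B₃ j hB₃3
      have c2 := hE3 X₁ j hX₁3
      have c3 := hE3 Y₁ j (isCoprime_three_int_iff.2 hY₁n)
      have c4 := hEA j hY₁n hA₃n hh'n
      rw [ht, hEM, hT'] at hR
      simp only [mul_zero, add_zero, pow_one, pow_zero, one_mul] at hR
      exact eq_one_of_relation_left c1 c2 c3 c4 hR
    · have h3r : 3 ∣ B₃ := hb ▸ (dvd_pow_self 3 ht).mul_right _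
      have hj0 := hj ((h3r.mul_right _).neg_right)
      rw [hj0] at hR
      simp only [pow_zero, one_mul, mul_one, one_pow] at hR
      -- `(3/β)₃` occurs to the third power if `9` exactly divides `r`, and is `1` if `27 ∣ r`
      by_cases ht1 : t = 1
      · rwa [ht1, show 1 + 2 * 1 = 3 from rfl, hT3, one_mul] at hR
      · have h9r : (9 : ℤ) ∣ -(B₃ * X₁) := by
          rw [dvd_neg]
          refine Dvd.dvd.mul_right ?_ _
          rw [hb]
          exact Dvd.dvd.mul_right (by
            have := pow_dvd_pow (3 : ℤ) (show 2 ≤ t by omega)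
            norm_num at this; exact this) _
        rwa [cubicSymbol_three_add_mul_sqrtNegThree hs3' h9r hpq, one_pow, one_mul] at hR
  · have hB₂n : ¬ 3 ∣ B₂ := fun h' => hr3 (h'.mul_right _)
    have hB₂3 := isCoprime_three_int_iff.2 hB₂n
    have hr3' := isCoprime_three_int_iff.2 hr3
    obtain ⟨l, y', hy', hy'n⟩ := exists_eq_pow_mul hp3 hY₁0
    obtain ⟨j, hj, hT3, hT, hR⟩ := exists_cubicSymbol_relation (b := B₂) (h := h') (y := y')
      (n := n) (κ := 2 * i) (κ' := 1 + 2 * l) hr3' hrs hB₂3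
      (isCoprime_three_int_iff.2 hh'n) (isCoprime_three_int_iff.2 hy'n) (by
        intro ℓ hℓ hd
        have hℓ' := Nat.prime_iff_prime_int.1 hℓ
        rcases hℓ'.dvd_or_dvd hd with hd | hd
        · rcases hℓ'.dvd_or_dvd hd with hd | hd
          · exact (hd.mul_right _).mul_right _
          · exact hprime ℓ hℓ (hh' ▸ hd.mul_left _)
        · exact ((hy' ▸ hd.mul_left _ : (ℓ : ℤ) ∣ Y₁).mul_left _).mul_left _) hM3 hβM (by
        refine ((hdvd _ _).mul_left (((h * k) ^ 2 : ℤ) : EisensteinInt)).trans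
          (dvd_of_eq ?_)
        rw [← Int.cast_mul, ← hrel, hh', hy']; push_cast; ring)
    by_cases hs3 : 3 ∣ A₃ * Y₁
    · have hj0 := hj hs3
      rw [hj0] at hR
      simp only [pow_zero, one_mul, mul_one, one_pow] at hR
      by_cases hs9 : (9 : ℤ) ∣ A₃ * Y₁
      · rwa [cubicSymbol_three_add_mul_sqrtNegThree hr3' hs9 hrs, one_pow, one_pow, one_mul] at hR
      by_cases hl : l = 0
      · -- `v₃(A) = v₃(h) + 1`, which the cubefreeness excludes
        exfalso
        rw [hl, pow_zero, one_mul] at hy'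
        rw [← hy'] at hy'n
        obtain ⟨A₄, hA₄⟩ := (hp3.dvd_or_dvd hs3).resolve_right hy'n
        have hA₄n : ¬ 3 ∣ A₄ := by
          rintro ⟨c, rfl⟩
          exact hs9 ⟨c * Y₁, by rw [hA₄]; ring⟩
        obtain ⟨c, hc⟩ := (hp3.dvd_or_dvd (hY ▸ hY3)).resolve_right hy'n
        refine Nat.succ_ne_zero i (valuation_left_eq_zero hN hcf Nat.prime_three (τ := i + 1)
          (A' := h' * k * A₄) ?_ ?_ ?_ ?_)
        · rw [hA, hh', hA₄]; push_cast; ring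
        · exact hp3.not_dvd_mul (hp3.not_dvd_mul hh'n hk3n) hA₄n
        · exact ⟨c * h' * B₂, by rw [hB', hh', hc]; push_cast; ring⟩
        · have h3D : (3 : ℤ) ∣ D * c := by
            by_cases hD3 : (3 : ℤ) ∣ D
            · exact hD3.mul_right _
            · have h9Y := h9 (hA ▸ (hA₄ ▸ (dvd_mul_right 3 A₄)).mul_left _)
                (hB ▸ (hc ▸ (dvd_mul_right 3 c)).mul_right _) hD3
              rw [hY, hc, show (9 : ℤ) = 3 * 3 by norm_num, mul_assoc] at h9Y
              have := Int.dvd_of_mul_dvd_mul_left (by norm_num) h9Y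
              exact ((hp3.dvd_or_dvd this).resolve_right hy'n).mul_left _
          obtain ⟨d, hd⟩ := h3D
          exact ⟨d * c * (h' * B₂) ^ 2, by
            rw [hB', hh', hc]; push_cast
            linear_combination (3 : ℤ) ^ (2 * i + 2) * c * (h' * B₂) ^ 2 * hd⟩
      · have h3Y₁ : 3 ∣ Y₁ := hy' ▸ (dvd_pow_self 3 hl).mul_right _
        have hl1 : l = 1 := by
          by_contra hl1
          refine hs9 (Dvd.dvd.mul_left ?_ _)
          rw [hy']
          exact Dvd.dvd.mul_right (by
            have := pow_dvd_pow (3 : ℤ) (show 2 ≤ l by omega)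
            norm_num at this; exact this) _
        have hi0 : i = 0 := by
          by_contra hi
          have h3h : 3 ∣ h := hh' ▸ (dvd_pow_self 3 hi).mul_right _
          exact hp3.not_isUnit (hBY.isUnit_of_dvd' (hB₁ ▸ h3h.mul_right _) h3Y₁)
        rwa [hl1, hi0, show 1 + 2 * 1 = 3 from rfl, hT3, mul_zero, pow_zero, one_mul] at hR
    · have hA₃n : ¬ 3 ∣ A₃ := fun h' => hs3 (h'.mul_right _)
      have hY₁n : ¬ 3 ∣ Y₁ := fun h' => hs3 (h'.mul_left _)
      have hi0 := hh3 hY₁n hA₃n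
      have hl0 : l = 0 := by
        by_contra hl
        exact hY₁n (hy' ▸ (dvd_pow_self 3 hl).mul_right _)
      rw [hi0, pow_zero, one_mul] at hh'
      rw [hl0, pow_zero, one_mul] at hy'
      rw [← hh'] at hh'n hR
      rw [← hy'] at hR
      have hY₁3 := isCoprime_three_int_iff.2 hY₁n
      have hA₃3 := isCoprime_three_int_iff.2 hA₃n
      have hT' := hT (isCoprime_three_int_iff.2 hs3)
      rw [hEmul _ _ _ hB₂3 hX₁3, hEmul _ _ _ hA₃3 hY₁3] at hT'
      have c1 := hE3 B₂ j hB₂3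
      have c2 := hE3 X₁ j hX₁3
      have c3 := hE3 Y₁ j hY₁3
      have c5 := hE3 A₃ j hA₃3
      have c4 := hEA j hY₁n hA₃n hh'n
      rw [hi0, hl0, hEM, hT'] at hR
      simp only [mul_zero, add_zero, pow_one, pow_zero, one_mul] at hR
      exact eq_one_of_relation_right c1 c2 c3 c5 c4 hR

end EisensteinInt

/-! ### The theorem on values of binary quadratic forms -/

theorem oddCommonPart_dvd_re {D : ℤ} (u : ℤ√D) : oddCommonPart u ∣ u.re := by
  have h : (∏ p ∈ (Int.gcd u.re u.im).primeFactors.filter (fun p : ℕ => Odd p ∧ ¬ (p : ℤ) ∣ D), p) ∣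
      Int.gcd u.re u.im :=
    (Finset.prod_dvd_prod_of_subset _ _ _ (Finset.filter_subset _ _)).trans
      (Nat.prod_primeFactors_dvd _)
  have h2 := Int.natCast_dvd_natCast.2 h
  rw [Nat.cast_prod] at h2
  exact h2.trans (Int.gcd_dvd_left ..)

theorem oddCommonPart_ne_zero {D : ℤ} (u : ℤ√D) : oddCommonPart u ≠ 0 := by
  refine Finset.prod_ne_zero_iff.2 fun p hp => ?_
  have := (Nat.prime_of_mem_primeFactors (Finset.mem_filter.1 hp).1).ne_zero
  exact_mod_cast this

theorem dvd_oddCommonPart {D : ℤ} {u : ℤ√D} (hu : u.im ≠ 0) {p : ℕ} (hp : p.Prime) (h2 : p ≠ 2)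
    (hre : (p : ℤ) ∣ u.re) (him : (p : ℤ) ∣ u.im) (hD : ¬ (p : ℤ) ∣ D) :
    (p : ℤ) ∣ oddCommonPart u := by
  refine Finset.dvd_prod_of_mem (fun p : ℕ => (p : ℤ)) (Finset.mem_filter.2 ⟨?_, ?_, hD⟩)
  · refine Nat.mem_primeFactors.2 ⟨hp, ?_, ?_⟩
    · exact Int.natCast_dvd_natCast.1 (Int.dvd_coe_gcd hre him)
    · exact fun h => hu (Int.gcd_eq_zero_iff.1 h).2
  · exact hp.odd_of_ne_two h2

open EisensteinInt in
theorem theorem2p4 (D : ℤ) (hD : 1 < D) (hDsq : Squarefree D)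
    (u : ℤ√D) (hu : u ∈ cubicNormSet D)
    (a b c : ℤ) (hf : IsPrimitiveForm (-27 * oddCommonPart u ^ 2 * D) a b c)
    (x y : ℤ) (hcop : IsCoprime (a * formValue a b c x y) (3 * u.norm * D * y)) :
    symbolL u a b c x y = symbolR u a b := by
  obtain ⟨⟨n, hn⟩, -, hcf⟩ := hu
  obtain ⟨-, -, hdisc⟩ := hf
  unfold symbolL symbolR
  have hfdef : a * formValue a b c x y =
      (a * x + b * y) ^ 2 + 27 * oddCommonPart u ^ 2 * D * y ^ 2 := by
    unfold formValue; linear_combination (-y ^ 2) * hdisc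
  have hC0 := oddCommonPart_ne_zero u
  obtain ⟨A', hA'⟩ := oddCommonPart_dvd_re u
  obtain ⟨B', hB'⟩ := oddCommonPart_dvd_im u
  have hdvdC := fun (h : u.im ≠ 0) p hp h2 => dvd_oddCommonPart (u := u) h (p := p) hp h2
  have hB'' : u.im / oddCommonPart u = B' := by
    rw [hB']; exact Int.mul_ediv_cancel_left _ hC0
  rw [hB'']
  have hnorm : u.re ^ 2 - D * u.im ^ 2 = n ^ 3 := by rw [← hn, Zsqrtd.norm_def]; ring
  rw [hn] at hcop
  generalize formValue a b c x y = f at *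
  generalize oddCommonPart u = C at *
  generalize u.re = A at *
  generalize u.im = B at *
  clear hD hDsq hn u hB''
  change cubicSymbol (((9 * A * y : ℤ) : EisensteinInt) +
      ((B' * (a * x + b * y) : ℤ) : EisensteinInt) * sqrtNegThree) (f : EisensteinInt) =
    cubicSymbol (((9 * A : ℤ) : EisensteinInt) -
      ((B' * b : ℤ) : EisensteinInt) * sqrtNegThree) (a : EisensteinInt)
  have hM3 : IsCoprime (a * f) 3 := hcop.of_mul_right_left.of_mul_right_left.of_mul_right_left
  have hMn3 : IsCoprime (a * f) (n ^ 3) :=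
    hcop.of_mul_right_left.of_mul_right_left.of_mul_right_right
  have hMD : IsCoprime (a * f) D := hcop.of_mul_right_left.of_mul_right_right
  have hMy : IsCoprime (a * f) y := hcop.of_mul_right_right
  have hMn : IsCoprime (a * f) n := (IsCoprime.pow_right_iff (by norm_num)).1 hMn3
  have hMC : IsCoprime (a * f) C := by
    refine hMn3.of_isCoprime_of_dvd_right ⟨C * A' ^ 2 - D * C * B' ^ 2, ?_⟩
    rw [← hnorm, hA', hB']; ring
  have ha3 := hM3.of_mul_left_left
  have hf3 := hM3.of_mul_left_right
  have ha3' := isCoprime_intCast_three.2 ha3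
  have hf3' := isCoprime_intCast_three.2 hf3
  by_cases hy0 : y = 0
  · -- then `a f` is a unit
    rw [hy0, isCoprime_zero_right] at hMy
    rw [cubicSymbol_of_isUnit (isUnit_intCast_iff.2 (isUnit_of_mul_isUnit_right hMy)),
      cubicSymbol_of_isUnit (isUnit_intCast_iff.2 (isUnit_of_mul_isUnit_left hMy))]
  by_cases hB0 : B = 0
  · have hB'0 : B' = 0 := (mul_eq_zero.1 (hB'.symm.trans hB0)).resolve_left hC0
    have hMA : IsCoprime (a * f) A := by
      refine hMn3.of_isCoprime_of_dvd_right ⟨A, ?_⟩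
      rw [← hnorm, hB0]; ring
    have hM9A : IsCoprime (a * f) (9 * A) := by
      rw [show (9 : ℤ) = 3 ^ 2 by norm_num]
      exact hM3.pow_right.mul_right hMA
    simp only [hB'0, zero_mul, Int.cast_zero, add_zero, sub_zero]
    rw [cubicSymbol_intCast hf3 (hM9A.mul_right hMy).of_mul_left_right.symm,
      cubicSymbol_intCast ha3 hM9A.of_mul_left_left.symm]
  -- `X = a x + b y` and `Y = -3 C y` give `X ^ 2 + 3 D Y ^ 2 = a f(x, y)`
  have hmain := cubicSymbol_eq_one_of_norm_eq_cube (M := a * f) (X := a * x + b * y)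
    (Y := -(3 * C * y)) hnorm hcf (by rw [hfdef]; ring)
    (((hM3.mul_right hMn).mul_right hMD).mul_right
      (((hM3.mul_right hMC).mul_right hMy).neg_right))
    ⟨-(C * y), by ring⟩
    (fun ℓ hℓ h2 h3 h4 h5 => by
      rw [dvd_neg]
      exact ((hdvdC hB0 ℓ hℓ h2 h3 h4 h5).mul_left _).mul_right _)
    (fun h3 h4 h5 => by
      obtain ⟨t, ht⟩ := hdvdC hB0 3 Nat.prime_three (by norm_num) (by exact_mod_cast h3)
        (by exact_mod_cast h4) (by exact_mod_cast h5)
      exact ⟨-(t * y), by rw [ht]; push_cast; ring⟩)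
    hB0 (neg_ne_zero.2 (mul_ne_zero (mul_ne_zero (by norm_num) hC0) hy0))
  set αL : EisensteinInt := ((9 * A * y : ℤ) : EisensteinInt) +
      ((B' * (a * x + b * y) : ℤ) : EisensteinInt) * sqrtNegThree with hαL
  set αR : EisensteinInt := ((9 * A : ℤ) : EisensteinInt) -
      ((B' * b : ℤ) : EisensteinInt) * sqrtNegThree with hαR
  -- multiplication of `B X + A Y √-3` by `√-3 / C`
  have hscale : ∀ m : ℤ, IsCoprime m 3 → IsCoprime m C →
      cubicSymbol (B * ((a * x + b * y : ℤ) : EisensteinInt) +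
        A * ((-(3 * C * y) : ℤ) : EisensteinInt) * sqrtNegThree) (m : EisensteinInt) =
      cubicSymbol αL (m : EisensteinInt) := by
    intro m hm hmC
    have hm' := isCoprime_intCast_three.2 hm
    have e : sqrtNegThree * (B * ((a * x + b * y : ℤ) : EisensteinInt) +
        A * ((-(3 * C * y) : ℤ) : EisensteinInt) * sqrtNegThree) = C * αL := by
      rw [hαL, hB']; push_cast
      linear_combination (-3 * A * C * y : EisensteinInt) * sqrtNegThree_sq
    have h1 := congrArg (fun z => cubicSymbol z (m : EisensteinInt)) e
    simp only [cubicSymbol_mul_left hm'] at h1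
    rwa [cubicSymbol_sqrtNegThree_intCast hm, one_mul, cubicSymbol_intCast hm hmC.symm,
      one_mul] at h1
  -- `α_L ≡ y · conj α_R` modulo `a`
  have hstar : cubicSymbol αL (a : EisensteinInt) = star (cubicSymbol αR (a : EisensteinInt)) := by
    have e : star αR = ((9 * A : ℤ) : EisensteinInt) +
        ((B' * b : ℤ) : EisensteinInt) * sqrtNegThree := by
      rw [hαR, star_sub, star_mul', star_sqrtNegThree, star_intCast, star_intCast]; ring
    rw [← cubicSymbol_star ha3', star_intCast, e,
      cubicSymbol_congr ha3' (α' := y * (((9 * A : ℤ) : EisensteinInt) +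
        ((B' * b : ℤ) : EisensteinInt) * sqrtNegThree)) ⟨B' * x * sqrtNegThree, by
          rw [hαL]; push_cast; ring⟩,
      cubicSymbol_mul_left ha3', cubicSymbol_intCast ha3 hMy.of_mul_left_left.symm, one_mul]
  rw [Int.cast_mul a f, cubicSymbol_mul_right (ne_zero_of_isCoprime_three ha3')
    (ne_zero_of_isCoprime_three hf3'), hscale a ha3 hMC.of_mul_left_left,
    hscale f hf3 hMC.of_mul_left_right, hstar] at hmain
  have hcube : cubicSymbol αR (a : EisensteinInt) ^ 3 = 1 := by
    refine cubicSymbol_pow_three ha3' ?_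
    have e : αR * star αR = ((81 * n ^ 3 + a * (3 * B' ^ 2 * c) : ℤ) : EisensteinInt) := by
      have h1 : 81 * A ^ 2 + 3 * (B' * b) ^ 2 = 81 * n ^ 3 + a * (3 * B' ^ 2 * c) := by
        rw [hB'] at hnorm
        linear_combination 81 * hnorm + 3 * B' ^ 2 * hdisc
      rw [← h1, hαR, star_sub, star_mul', star_sqrtNegThree, star_intCast, star_intCast]
      push_cast
      linear_combination (-(B' * b : EisensteinInt) ^ 2) * sqrtNegThree_sq
    have h2 : IsCoprime (81 * n ^ 3 + a * (3 * B' ^ 2 * c)) a := by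
      refine IsCoprime.add_mul_left_left ?_ _
      rw [show (81 : ℤ) = 3 ^ 4 by norm_num]
      exact (hM3.of_mul_left_left.symm.pow_left).mul_left hMn3.of_mul_left_left.symm
    have h3 := isCoprime_intCast.2 h2
    rw [← e] at h3
    exact h3.of_mul_left_left
  -- `(α_L/f)₃ R ^ 2 = 1` and `R ^ 3 = 1`
  rw [star_eq_sq hcube] at hmain
  linear_combination cubicSymbol αR (a : EisensteinInt) * hmain -
    cubicSymbol αL (f : EisensteinInt) * hcube
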